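/- For $a\in\mathbb R$, $k\in\mathbb N_0$ let $(a)_k=a(a+1)\cdots(a+k-1)$. For a vector $y=(y_1,\dots,y_n)$ put $|y|=y_1+\cdots+y_n$, $|\mathbf y_j|=y_1+\cdots+y_j$, $|\mathbf y^j|=y_j+\cdots+y_n$ (empty sums are $0$). Let $d\ge 1$, $\nu\in\mathbb N_0^d$, $x\in\mathbb R^d$, $\ell=(\ell_1,\dots,\ell_{d+1})$, and let $$\widehat{\mathsf Q}_\nu(x;\ell,N)=\frac1{(-N)_{|\nu|}}\prod_{j=1}^d(-N_j)_{\nu_j}\,{}_3F_2\!\left(\begin{matrix}-\nu_j,\ \nu_j-\ell_j-\mathsf a_j-1,\ -x_j\\ -\ell_j,\ -N_j\end{matrix};1\right),$$ where $\mathsf a_j=|\boldsymbol\ell^{j+1}|-2|\boldsymbol\nu^{j+1}|$ and $N_j=N-|\mathbf x_{j-1}|-|\boldsymbol\nu^{j+1}|$; here $(-N_j)_{\nu_j}/(-N_j)_m$ is read as $(-N_j+m)_{\nu_j-m}$ in the terms of the hypergeometric sum, so that $\widehat{\mathsf Q}_\nu$ is a polynomial in $x$. For $1\le i\le d$ define $$\begin{aligned}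 B_i^{0,0}&=|\boldsymbol\nu^{i}|(|\boldsymbol\nu^{i}|-|\boldsymbol\ell^{i}|-1)+|\boldsymbol\nu^{i+1}|(|\boldsymbol\nu^{i+1}|-|\boldsymbol\ell^{i+1}|-1)+\tfrac12|\boldsymbol\ell^{i+1}|(|\boldsymbol\ell^{i}|+2),\\ B_i^{0,1}&=-\nu_i(\nu_i+2|\boldsymbol\nu^{i+1}|-|\boldsymbol\ell^{i}|-1),\qquad B_i^{0,-1}=(\ell_i-\nu_i)(\nu_i+2|\boldsymbol\nu^{i+1}|-|\boldsymbol\ell^{i+1}|-1),\\ B_i^{1,0}&=(\ell_i-\nu_i)(\nu_i+2|\boldsymbol\nu^{i+1}|-|\boldsymbol\ell^{i}|-1),\qquad B_i^{-1,0}=-\nu_i(\nu_i+2|\boldsymbol\nu^{i+1}|-|\boldsymbol\ell^{i+1}|-1),\\ B_i^{1,1}&=(\nu_i+2|\boldsymbol\nu^{i+1}|-|\boldsymbol\ell^{i}|-1)(\nu_i+2|\boldsymbol\nu^{i+1}|-|\boldsymbol\ell^{i}|),\qquad B_i^{-1,1}=\nu_i(\nu_i-1),\\ B_i^{1,-1}&=(\ell_i-\nu_i)(\ell_i-\nu_i-1),\qquad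 B_i^{-1,-1}=(\nu_i+2|\boldsymbol\nu^{i+1}|-|\boldsymbol\ell^{i+1}|-1)(\nu_i+2|\boldsymbol\nu^{i+1}|-|\boldsymbol\ell^{i+1}|-2), \end{aligned}$$ $B_0^{0,0}=-N+|\ell|/2$, $B_0^{0,1}=N-|\nu|$, $B_0^{0,-1}=|\nu|-|\ell|+N-1$, and, with $s_i=2|\boldsymbol\nu^i|-|\boldsymbol\ell^i|$, $b_i^0=s_i(s_i-2)/2$, $b_i^1=s_i(s_i-1)$, $b_i^{-1}=(s_i-2)(s_i-1)$. For $\mu\in\{-1,0,1\}^d$ and $\mu_0=\mu_{d+1}=0$ let $C_\mu=\prod_{i=0}^dB_i^{\mu_i,\mu_{i+1}}\big/\prod_{i=1}^db_i^{\mu_i}$, and let $$\mathcal L_d^\nu(\nu;\ell;N)=\sum_{0\ne\mu\in\{-1,0,1\}^d}C_\mu\Big(\prod_{i=1}^dE_{\nu_i}^{\mu_i-\mu_{i+1}}-1\Big),$$ where $E_{\nu_i}f_\nu=f_{\nu+e_i}$ and values $f_{\nu'}$ at indices with a negative component (whose coefficients vanish) are ignored. For $1\le k\le d$ put $$\mathcal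 L_k^\nu=\mathcal L_k^\nu\big(\nu_1,\dots,\nu_k;\ \ell_1,\dots,\ell_k,|\boldsymbol\ell^{k+1}|-2|\boldsymbol\nu^{k+1}|;\ N-|\boldsymbol\nu^{k+1}|\big)$$ (for $k=d$ this is $\mathcal L_d^\nu(\nu;\ell;N)$), and consider the equations $$\mathcal L_k^\nu\,\widehat{\mathsf Q}_\nu(x;\ell,N)=|\mathbf x_k|\,\widehat{\mathsf Q}_\nu(x;\ell,N),\qquad k=1,\dots,d.\tag{$*$}$$ (1) Generic parameters. Let $\ell\in\mathbb R^{d+1}$, $N\in\mathbb R$ with $N\notin\mathbb N_0$, and $\ell_i\notin\mathbb N_0$, $|\boldsymbol\ell^i|\notin\mathbb Z$ for $1\le i\le d$. Then $(*)$ holds for all $\nu\in\mathbb N_0^d$ and all $x\in\mathbb R^d$, and $\mathcal L_1^\nu,\dots,\mathcal L_d^\nu$ commute as operators on functions on $\mathbb N_0^d$. (2) Integer parameters. Let $\ell_i,N\in\mathbb N_0$ with $\ell_i\le N$ and $\ell_i+\ell_j\ge N$ for $i\ne j$, and put $H=\{\nu\in\mathbb N_0^d:|\nu|\le N,\ |\nu|\le|\ell|-N,\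 \nu_j\le\ell_j,\ \nu_j\le\mathsf a_j,\ 1\le j\le d\}$ and $V=\{x\in\mathbb N_0^d:x_i\le\ell_i\ (1\le i\le d),\ N-\ell_{d+1}\le|x|\le N\}$. Let $1\le k\le d$. (a) If $\nu$ and all indices with nonnegative components that occur on the left-hand side of $(*)$ belong to $H$, then the $k$-th equation $(*)$ holds for all $x\in\mathbb R^d$. (b) If $\nu\in H$ and the denominators $b_i^{0},b_i^{\pm1}$, $1\le i\le k$, do not vanish at $\nu$, then the $k$-th equation $(*)$ holds for all $x\in V$, where terms with coefficient $0$ are omitted. (c) For all $1\le j,k\le d$ one has $(\mathcal L_j^\nu\mathcal L_k^\nu f)_\nu=(\mathcal L_k^\nu\mathcal L_j^\nu f)_\nu$ for every function $f$ on $\mathbb N_0^d$ and every $\nu\in\mathbb N_0^d$ such that the denominators of all coefficients involved do not vanish (those of $\mathcal L_j^\nu$ and $\mathcal L_k^\nu$ at $\nu$, those of $\mathcal L_k^\nu$ at the nonnegative indices occurring in $\mathcal L_j^\nu$, and those of $\mathcal L_j^\nu$ at the nonnegative indices occurring in $\mathcal L_k^\nu$). -/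

import Mathlib

namespace HahnRec

noncomputable section

/-- The Pochhammer symbol `(a)_k = a (a+1) ⋯ (a+k-1)`. -/
def poch (a : ℝ) (k : ℕ) : ℝ := (ascPochhammer ℝ k).eval a

/-- `|y_j| = y_1 + ⋯ + y_j`, where `y_i` (counted from `1`) is `y ⟨i - 1, _⟩`. -/
def headSum {M : Type} [AddCommMonoid M] {n : ℕ} (y : Fin n → M) (j : ℕ) : M :=
  ∑ i : Fin n with i.val + 1 ≤ j, y i

/-- `|y^j| = y_j + ⋯ + y_n`, where `y_i` (counted from `1`) is `y ⟨i - 1, _⟩`;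
it is `0` for `j > n`. -/
def tailSum {M : Type} [AddCommMonoid M] {n : ℕ} (y : Fin n → M) (j : ℕ) : M :=
  ∑ i : Fin n with j ≤ i.val + 1, y i

/-! ### Hahn polynomials -/

/-- The Hahn polynomial with parameters `-l₁ - 1`, `-l₂ - 1`, as a terminating
hypergeometric sum `₃F₂(-n, n - l₁ - l₂ - 1, -x; -l₁, -M; 1)`. -/
def hahn (n : ℕ) (x l₁ l₂ M : ℝ) : ℝ :=
  ∑ k ∈ Finset.range (n + 1),
    poch (-(n : ℝ)) k * poch (n - l₁ - l₂ - 1) k * poch (-x) k /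
      (poch (-l₁) k * poch (-M) k * (k.factorial : ℝ))

/-- The product `(-M)_n · hahn n x l₁ l₂ M`, with `(-M)_n / (-M)_k` written as
`(-M + k)_{n-k}`, so that it is a polynomial in `x` and `M`
(see `hahnReg_eq`). -/
def hahnReg (n : ℕ) (x l₁ l₂ M : ℝ) : ℝ :=
  ∑ k ∈ Finset.range (n + 1),
    poch (-(n : ℝ)) k * poch (n - l₁ - l₂ - 1) k * poch (-x) k /
      (poch (-l₁) k * (k.factorial : ℝ)) * poch (-M + k) (n - k)

theorem poch_add (a : ℝ) (k m : ℕ) : poch a (k + m) = poch a k * poch (a + k) m := by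
  unfold poch
  rw [← ascPochhammer_mul]
  simp [Polynomial.eval_comp]

theorem hahnReg_eq (n : ℕ) (x l₁ l₂ M : ℝ) (h : poch (-M) n ≠ 0) :
    hahnReg n x l₁ l₂ M = poch (-M) n * hahn n x l₁ l₂ M := by
  unfold hahnReg hahn
  rw [Finset.mul_sum]
  refine Finset.sum_congr rfl fun k hk => ?_
  have hkn : k + (n - k) = n := by
    have := Finset.mem_range.mp hk
    omega
  have h1 : poch (-M) n = poch (-M) k * poch (-M + k) (n - k) := by
    rw [← poch_add, hkn]
  have h2 : poch (-M) k ≠ 0 := fun h0 => h (by rw [h1, h0, zero_mul])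
  rw [h1, mul_assoc (poch (-l₁) k), mul_comm (poch (-M) k) (k.factorial : ℝ), ← mul_assoc,
    ← div_div]
  field_simp

/-- The normalized Hahn polynomial `Q̂_ν(x; ℓ, N)` in `d` variables. -/
def hahnQ {d : ℕ} (ν : Fin d → ℕ) (x : Fin d → ℝ) (ℓ : Fin (d + 1) → ℝ) (N : ℝ) : ℝ :=
  1 / poch (-N) (∑ i, ν i) *
    ∏ i : Fin d,
      hahnReg (ν i) (x i) (ℓ i.castSucc)
        (tailSum ℓ (i.val + 2) - 2 * (tailSum ν (i.val + 2) : ℕ))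
        (N - headSum x i.val - (tailSum ν (i.val + 2) : ℕ))

/-! ### The operators acting on the indices -/

/-- The coefficients `B_i^{p,q}`, `1 ≤ i ≤ d`. The first argument of type `Fin d` is `i - 1`. -/
def B {d : ℕ} (ν : Fin d → ℕ) (ℓ : Fin (d + 1) → ℝ) (i : Fin d) (p q : SignType) : ℝ :=
  let n : ℝ := (ν i : ℝ)
  let l : ℝ := ℓ i.castSucc
  let n₀ : ℝ := ((tailSum ν (i.val + 1) : ℕ) : ℝ)
  let n₁ : ℝ := ((tailSum ν (i.val + 2) : ℕ) : ℝ)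
  let l₀ : ℝ := tailSum ℓ (i.val + 1)
  let l₁ : ℝ := tailSum ℓ (i.val + 2)
  match p, q with
  | .zero, .zero => n₀ * (n₀ - l₀ - 1) + n₁ * (n₁ - l₁ - 1) + l₁ * (l₀ + 2) / 2
  | .zero, .pos => -n * (n + 2 * n₁ - l₀ - 1)
  | .zero, .neg => (l - n) * (n + 2 * n₁ - l₁ - 1)
  | .pos, .zero => (l - n) * (n + 2 * n₁ - l₀ - 1)
  | .neg, .zero => -n * (n + 2 * n₁ - l₁ - 1)
  | .pos, .pos => (n + 2 * n₁ - l₀ - 1) * (n + 2 * n₁ - l₀)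
  | .neg, .pos => n * (n - 1)
  | .pos, .neg => (l - n) * (l - n - 1)
  | .neg, .neg => (n + 2 * n₁ - l₁ - 1) * (n + 2 * n₁ - l₁ - 2)

/-- The coefficients `B_0^{0,q}`. -/
def B₀ {d : ℕ} (ν : Fin d → ℕ) (ℓ : Fin (d + 1) → ℝ) (N : ℝ) (q : SignType) : ℝ :=
  let n : ℝ := ((∑ i, ν i : ℕ) : ℝ)
  match q with
  | .zero => -N + (∑ i, ℓ i) / 2
  | .pos => N - n
  | .neg => n - (∑ i, ℓ i) + N - 1

/-- The denominators `b_i^p`, `1 ≤ i ≤ d`. The argument of type `Fin d` is `i - 1`. -/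
def b {d : ℕ} (ν : Fin d → ℕ) (ℓ : Fin (d + 1) → ℝ) (i : Fin d) (p : SignType) : ℝ :=
  let s : ℝ := 2 * ((tailSum ν (i.val + 1) : ℕ) : ℝ) - tailSum ℓ (i.val + 1)
  match p with
  | .zero => s * (s - 2) / 2
  | .pos => s * (s - 1)
  | .neg => (s - 2) * (s - 1)

/-- `μ_j` for every `j`, counted from `1`, with `μ_j = 0` for `j = 0` and for `j > k`. -/
def ext {k : ℕ} (μ : Fin k → SignType) (j : ℕ) : SignType :=
  if h : 1 ≤ j ∧ j ≤ k then μ ⟨j - 1, by omega⟩ else 0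

/-- The coefficient `C_μ = ∏_{k=0}^d B_k^{μ_k, μ_{k+1}} / ∏_{k=1}^d b_k^{μ_k}`. -/
def C {d : ℕ} (ν : Fin d → ℕ) (ℓ : Fin (d + 1) → ℝ) (N : ℝ) (μ : Fin d → SignType) : ℝ :=
  B₀ ν ℓ N (ext μ 1) * (∏ i : Fin d, B ν ℓ i (ext μ (i.val + 1)) (ext μ (i.val + 2))) /
    ∏ i : Fin d, b ν ℓ i (ext μ (i.val + 1))

/-- The index `ν` shifted by `∏_{i=1}^k E_{ν_i}^{μ_i - μ_{i+1}}`; its components may be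
negative. -/
def shift {d k : ℕ} (ν : Fin d → ℕ) (μ : Fin k → SignType) : Fin d → ℤ :=
  fun i => (ν i : ℤ) + ((ext μ (i.val + 1) : ℤ) - (ext μ (i.val + 2) : ℤ))

/-- The value of `f` at an integer index; the value at an index with a negative component is
ignored, that is, `0`. -/
def atIndex {d : ℕ} (f : (Fin d → ℕ) → ℝ) (n : Fin d → ℤ) : ℝ :=
  if ∀ i, 0 ≤ n i then f (fun i => (n i).toNat) else 0

/-- The operator `L^ν_d(ν; ℓ; N)`. -/
def recOpFull {d : ℕ} (ℓ : Fin (d + 1) → ℝ) (N : ℝ) (f : (Fin d → ℕ) → ℝ) (ν : Fin d → ℕ) : ℝ :=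
  ∑ μ : Fin d → SignType with μ ≠ 0, C ν ℓ N μ * (atIndex f (shift ν μ) - f ν)

/-- The first `k` indices `(ν_1, …, ν_k)`. -/
def headIdx {d k : ℕ} (hk : k ≤ d) (ν : Fin d → ℕ) : Fin k → ℕ := fun i => ν (Fin.castLE hk i)

/-- The parameters `(ℓ_1, …, ℓ_k, |ℓ^{k+1}| - 2 |ν^{k+1}|)`. -/
def headPar {d k : ℕ} (hk : k ≤ d) (ν : Fin d → ℕ) (ℓ : Fin (d + 1) → ℝ) : Fin (k + 1) → ℝ :=
  Fin.snoc (α := fun _ => ℝ) (fun i : Fin k => ℓ (Fin.castLE hk i).castSucc)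
    (tailSum ℓ (k + 1) - 2 * (tailSum ν (k + 1) : ℕ))

/-- The operator
`L^ν_k = L^ν_k(ν_1, …, ν_k; ℓ_1, …, ℓ_k, |ℓ^{k+1}| - 2 |ν^{k+1}|; N - |ν^{k+1}|)`,
acting on functions of `ν_1, …, ν_d`; for `k = d` it is `L^ν_d(ν; ℓ; N)`
(see `recOp_self`). -/
def recOp {d : ℕ} (k : ℕ) (hk : k ≤ d) (ℓ : Fin (d + 1) → ℝ) (N : ℝ)
    (f : (Fin d → ℕ) → ℝ) (ν : Fin d → ℕ) : ℝ :=
  ∑ μ : Fin k → SignType with μ ≠ 0,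
    C (headIdx hk ν) (headPar hk ν ℓ) (N - (tailSum ν (k + 1) : ℕ)) μ *
      (atIndex f (shift ν μ) - f ν)

theorem recOp_self {d : ℕ} (ℓ : Fin (d + 1) → ℝ) (N : ℝ) (f : (Fin d → ℕ) → ℝ) :
    recOp d le_rfl ℓ N f = recOpFull ℓ N f := by
  funext ν
  have h1 : tailSum ν (d + 1) = 0 := by
    unfold tailSum
    apply Finset.sum_eq_zero
    intro i hi
    have := (Finset.mem_filter.mp hi).2
    omega
  have h2 : tailSum ℓ (d + 1) = ℓ (Fin.last d) := by
    unfold tailSum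
    rw [Finset.sum_eq_single (Fin.last d)]
    · intro i hi hne
      exact absurd (Fin.ext (by
        have := (Finset.mem_filter.mp hi).2
        simp only [Fin.val_last]
        omega)) hne
    · intro h
      simp at h
  have h3 : headPar le_rfl ν ℓ = ℓ := by
    funext i
    refine Fin.lastCases ?_ (fun j => ?_) i
    · simp [headPar, h1, h2]
    · simp [headPar]
  have h4 : headIdx le_rfl ν = ν := rfl
  unfold recOp recOpFull
  rw [h3, h4, h1]
  simp

/-! ### Parameters and index sets -/

/-- Generic parameters: none of the denominators in the polynomials `Q̂_ν` and in the operators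
`L^ν_k` vanishes for any index. -/
def Generic {d : ℕ} (ℓ : Fin (d + 1) → ℝ) (N : ℝ) : Prop :=
  (∀ n : ℕ, N ≠ n) ∧ (∀ (i : Fin d) (n : ℕ), ℓ i.castSucc ≠ n) ∧
    ∀ (i : Fin d) (m : ℤ), tailSum ℓ (i.val + 1) ≠ m

/-- The condition `ℓ_i ≤ N` and `ℓ_i + ℓ_j ≥ N` for `i ≠ j`. -/
def Admissible {d : ℕ} (ℓ : Fin (d + 1) → ℕ) (N : ℕ) : Prop :=
  (∀ i, ℓ i ≤ N) ∧ ∀ i j, i ≠ j → N ≤ ℓ i + ℓ j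

/-- The lattice polyhedron `V_{ℓ,N}^d`. -/
def V {d : ℕ} (ℓ : Fin (d + 1) → ℕ) (N : ℕ) : Set (Fin d → ℕ) :=
  {x | (∀ i : Fin d, x i ≤ ℓ i.castSucc) ∧ N ≤ (∑ i, x i) + ℓ (Fin.last d) ∧ ∑ i, x i ≤ N}

/-- The index set `H_{ℓ,N}^d`: `|ν| ≤ N`, `|ν| ≤ |ℓ| - N`, `ν_j ≤ ℓ_j` and
`ν_j ≤ |ℓ^{j+1}| - 2 |ν^{j+1}|`. -/
def H {d : ℕ} (ℓ : Fin (d + 1) → ℕ) (N : ℕ) : Set (Fin d → ℕ) :=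
  {ν | ∑ i, ν i ≤ N ∧ (∑ i, ν i) + N ≤ ∑ i, ℓ i ∧
    ∀ i : Fin d, ν i ≤ ℓ i.castSucc ∧
      ν i + 2 * tailSum ν (i.val + 2) ≤ tailSum ℓ (i.val + 2)}

/-- The indices with nonnegative components that occur in `(L^ν_k f)(ν)`, including `ν`. -/
def nbr {d : ℕ} (k : ℕ) (ν : Fin d → ℕ) : Set (Fin d → ℕ) :=
  {ν' | ∃ μ : Fin k → SignType, shift ν μ = fun i => (ν' i : ℤ)}

/-- The denominators `b_i^{±1}`, `b_i^0`, `1 ≤ i ≤ k`, of the coefficients of `L^ν_k` at the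
index `ν` do not vanish. -/
def Regular {d : ℕ} (k : ℕ) (ℓ : Fin (d + 1) → ℝ) (ν : Fin d → ℕ) : Prop :=
  ∀ i : Fin d, i.val < k → ∀ p : SignType, b ν ℓ i p ≠ 0

end

end HahnRec

namespace HahnRec

noncomputable section

/-! ### Pochhammer symbols -/

/-! Generic parameters. A shift by μ changes |ν^j| by μ_j (telescoping), so the j-th Hahn factor
only sees the degree shift μ_j - μ_{j+1} and the parameter shifts a_j ↦ a_j - 2μ_{j+1}, N_j ↦ N_j -
μ_{j+1}. For each fixed q = μ_2, a one-variable contiguous relation (`hahnReg_contiguous`) collapses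
the sum over μ_1 to the unshifted first factor times the boundary coefficient B_0 of the problem in
the remaining variables, with N replaced by N - x_1. Induction on d (`hahnP_recurrence`) therefore
yields the eigenvalue |x| - N + ℓ_{d+1}/2 for the sum over all μ, including μ = 0. At x = 0 every
normalized polynomial is 1, so the C_μ sum to -N + ℓ_{d+1}/2 (`sum_C`), and subtracting leaves |x|.
For k < d the polynomial is a factor untouched by the shifts times a polynomial of the same family
in k variables (`hahnQ_split`).

Commutation. The operators are simultaneously diagonal on ν ↦ Q̂_ν(x) for every x. At a fixed index
their commutator is a finite linear combination of values of f that vanishes on all these functions.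
Since the Q̂_ν are linearly independent as functions of x, it is zero.

Integer parameters. Adding one small irrational ε to all ℓ_i and to N makes the parameters generic,
and the identities survive ε → 0 wherever the terms converge. On V the only delicate terms have |ν'|
= N + 1: there the zero of B_0 cancels the pole of the normalization, and the remaining product
vanishes at the points of V (`hahnP_eq_zero`). -/

theorem poch_zero (a : ℝ) : poch a 0 = 1 := by simp [poch]

theorem poch_succ (a : ℝ) (k : ℕ) : poch a (k + 1) = poch a k * (a + k) := by
  simp [poch, ascPochhammer_succ_eval]

theorem poch_succ_left (a : ℝ) (k : ℕ) : poch a (k + 1) = a * poch (a + 1) k := by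
  rw [add_comm, poch_add, poch_succ, poch_zero]
  simp

theorem mul_poch_add_one (a : ℝ) (k : ℕ) : a * poch (a + 1) k = (a + k) * poch a k := by
  rw [← poch_succ_left, poch_succ, mul_comm]

theorem poch_ne_zero {a : ℝ} {k : ℕ} (h : ∀ m < k, a + m ≠ 0) : poch a k ≠ 0 := by
  induction k with
  | zero => simp [poch_zero]
  | succ k ih =>
    rw [poch_succ]
    exact mul_ne_zero (ih fun m hm => h m (by omega)) (h k (by omega))

theorem poch_neg_ne_zero {l : ℝ} (h : ∀ m : ℕ, l ≠ m) (k : ℕ) : poch (-l) k ≠ 0 :=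
  poch_ne_zero fun m _ h0 => h m (by linarith)

theorem poch_neg_natCast_eq_zero {n k : ℕ} (h : n < k) : poch (-(n : ℝ)) k = 0 := by
  obtain ⟨m, rfl⟩ := Nat.exists_eq_add_of_le (Nat.succ_le_of_lt h)
  rw [poch_add, Nat.succ_eq_add_one, poch_succ]
  simp

/-! ### Reciprocal factorials -/

/-- The reciprocal factorial `1 / z!`, which is `0` for negative `z`. -/
def recFact (z : ℤ) : ℝ := if 0 ≤ z then 1 / (z.toNat.factorial : ℝ) else 0

theorem recFact_natCast (n : ℕ) : recFact n = 1 / (n.factorial : ℝ) := by simp [recFact]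

theorem recFact_of_neg {z : ℤ} (h : z < 0) : recFact z = 0 := by simp [recFact, h]

/-- With reciprocal factorials extended by zero this holds for every integer, so terminating sums of
different degrees can share one summation range without boundary terms. -/
theorem recFact_sub_one (z : ℤ) : recFact (z - 1) = z * recFact z := by
  rcases lt_trichotomy z 0 with h | rfl | h
  · rw [recFact_of_neg h, recFact_of_neg (by omega), mul_zero]
  · simp [recFact]
  · obtain ⟨n, rfl⟩ : ∃ n : ℕ, z = n + 1 := ⟨(z - 1).toNat, by omega⟩
    rw [show (n : ℤ) + 1 - 1 = (n : ℤ) by ring, recFact_natCast]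
    have h2 := recFact_natCast (n + 1)
    rw [Nat.factorial_succ] at h2
    push_cast at h2 ⊢
    rw [h2]
    have : (n : ℝ) + 1 ≠ 0 := by positivity
    field_simp

theorem poch_neg_natCast (n k : ℕ) :
    poch (-(n : ℝ)) k = (-1) ^ k * (n.factorial : ℝ) * recFact (n - k) := by
  induction k with
  | zero =>
    have : (n.factorial : ℝ) ≠ 0 := by positivity
    simp [poch_zero, recFact_natCast, this]
  | succ k ih =>
    rw [poch_succ, ih, show ((n : ℤ) - ((k + 1 : ℕ) : ℤ)) = (n - k : ℤ) - 1 by push_cast; ring,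
      recFact_sub_one]
    push_cast
    ring

/-! ### Contiguous relations for the Hahn polynomials -/

/-- `hahnReg` with an integer degree, which is `0` for negative degrees. -/
def hahnZ (n : ℤ) (x l a M : ℝ) : ℝ := if 0 ≤ n then hahnReg n.toNat x l a M else 0

theorem hahnZ_natCast (n : ℕ) (x l a M : ℝ) : hahnZ n x l a M = hahnReg n x l a M := by
  simp [hahnZ]

/-- The part of the `k`-th term of a Hahn polynomial that depends on the degree only through
`e = n - l₁ - l₂ - 1`. -/
def hahnFactor (x l e M : ℝ) (k : ℕ) : ℝ :=
  (-1) ^ k * poch e k * poch (-x) k / (poch (-l) k * poch (-M) k * (k.factorial : ℝ))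

/-- Since (-n)_k = (-1)^k n! / (n-k)!, the reciprocal factorial cuts the sum off at k = n, and the
bound K becomes arbitrary. This puts contiguous polynomials on a common footing for termwise
comparison. -/
theorem hahnZ_eq_sum (n : ℤ) (x l a : ℝ) {M : ℝ} (hM : ∀ m : ℕ, M ≠ m) {K : ℕ} (hK : n < K) :
    hahnZ n x l a M = ∑ k ∈ Finset.range K, (n.toNat.factorial : ℝ) * poch (-M) n.toNat *
      recFact (n - k) * hahnFactor x l (n - l - a - 1) M k := by
  rcases lt_or_ge n 0 with hn | hn
  · rw [hahnZ, if_neg (by omega)]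
    symm
    refine Finset.sum_eq_zero fun k _ => ?_
    rw [recFact_of_neg (by omega)]
    ring
  · obtain ⟨n, rfl⟩ := Int.eq_ofNat_of_zero_le hn
    have hsub : Finset.range (n + 1) ⊆ Finset.range K := by
      intro k
      simp only [Finset.mem_range]
      omega
    rw [hahnZ_natCast, hahnReg, ← Finset.sum_subset hsub]
    · refine Finset.sum_congr rfl fun k hk => ?_
      have hkn : k + (n - k) = n := by
        have := Finset.mem_range.mp hk
        omega
      have h1 : poch (-M) n = poch (-M) k * poch (-M + k) (n - k) := by
        rw [← poch_add, hkn]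
      have h2 : poch (-M) k ≠ 0 := poch_neg_ne_zero hM k
      rw [Int.toNat_natCast, h1, poch_neg_natCast, hahnFactor]
      push_cast
      field_simp
    · intro k _ hk
      rw [recFact_of_neg]
      · ring
      · simp only [Finset.mem_range] at hk
        omega

section shifts

variable {x l e M : ℝ}

theorem hahnFactor_add_one (h : e ≠ 0) (k : ℕ) :
    hahnFactor x l (e + 1) M k = (e + k) / e * hahnFactor x l e M k := by
  have := mul_poch_add_one e k
  have h1 : poch (e + 1) k = (e + k) / e * poch e k := by
    field_simp
    linarith
  simp only [hahnFactor, h1]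
  ring

theorem hahnFactor_sub_one {k : ℕ} (h : e - 1 + k ≠ 0) :
    hahnFactor x l (e - 1) M k = (e - 1) / (e - 1 + k) * hahnFactor x l e M k := by
  have h0 := mul_poch_add_one (e - 1) k
  rw [sub_add_cancel] at h0
  have h1 : poch (e - 1) k = (e - 1) / (e - 1 + k) * poch e k := by
    field_simp
    linarith
  simp only [hahnFactor, h1]
  ring

theorem hahnFactor_pred (hM : ∀ m : ℕ, M ≠ m) (k : ℕ) :
    hahnFactor x l e (M - 1) k = M / (M - k) * hahnFactor x l e M k := by
  have h0 := mul_poch_add_one (-M) k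
  have hk : M - k ≠ 0 := sub_ne_zero.2 (hM k)
  have hM0 : M ≠ 0 := by simpa using hM 0
  have h2 : poch (-M) k ≠ 0 := poch_neg_ne_zero hM k
  have h1 : poch (-(M - 1)) k = (M - k) / M * poch (-M) k := by
    rw [show -(M - 1) = -M + 1 by ring]
    field_simp
    linarith
  simp only [hahnFactor, h1]
  field_simp

theorem hahnFactor_succ (hM : ∀ m : ℤ, M ≠ m) (k : ℕ) :
    hahnFactor x l e (M + 1) k = (M + 1 - k) / (M + 1) * hahnFactor x l e M k := by
  have h := hahnFactor_pred (x := x) (l := l) (e := e) (M := M + 1)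
    (fun m h => hM (m - 1) (by push_cast; linarith)) k
  have hk : M + 1 - k ≠ 0 := fun h0 => hM (k - 1) (by push_cast; linarith)
  have hM0 : M + 1 ≠ 0 := fun h0 => hM (-1) (by push_cast; linarith)
  rw [add_sub_cancel_right] at h
  rw [h]
  field_simp

theorem hahnFactor_index_succ (hl : ∀ m : ℕ, l ≠ m) (hM : ∀ m : ℕ, M ≠ m) (k : ℕ) :
    hahnFactor x l e M (k + 1) =
      -((e + k) * (k - x)) / ((k - l) * (k - M) * (k + 1)) * hahnFactor x l e M k := by
  have h1 : (k : ℝ) - l ≠ 0 := sub_ne_zero.2 (hl k).symm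
  have h2 : (k : ℝ) - M ≠ 0 := sub_ne_zero.2 (hM k).symm
  have h3 : (k : ℝ) + 1 ≠ 0 := by positivity
  have h4 := poch_neg_ne_zero hl k
  have h5 := poch_neg_ne_zero hM k
  simp only [hahnFactor, poch_succ, Nat.factorial_succ, pow_succ]
  push_cast
  rw [show -l + (k : ℝ) = k - l by ring, show -M + (k : ℝ) = k - M by ring]
  field_simp
  ring

end shifts

/-! ### The three-term recurrence in the degree -/

section

theorem factorial_mul_poch_succ (M : ℝ) (n : ℕ) :
    ((n + 1).factorial : ℝ) * poch (-M) (n + 1) =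
      n.factorial * poch (-M) n * ((n + 1) * (n - M)) := by
  rw [poch_succ, Nat.factorial_succ]
  push_cast
  ring

theorem hahnZ_natCast_eq_sum (n : ℕ) (x l a : ℝ) {M : ℝ} (hM : ∀ m : ℕ, M ≠ m) {K : ℕ}
    (hK : n < K) :
    hahnZ n x l a M = ∑ k ∈ Finset.range K, (n.factorial : ℝ) * poch (-M) n *
      ((n + 1 - k) * (recFact (n + 1 - k) * hahnFactor x l (n - l - a - 1) M k)) := by
  rw [hahnZ_eq_sum n x l a hM (by exact_mod_cast hK)]
  refine Finset.sum_congr rfl fun k _ => ?_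
  rw [show (n : ℤ) - k = (n + 1 - k : ℤ) - 1 by ring, recFact_sub_one, Int.toNat_natCast]
  push_cast
  ring

theorem hahnZ_succ_eq_sum (n : ℕ) (x l a : ℝ) {M : ℝ} (hM : ∀ m : ℕ, M ≠ m) {K : ℕ}
    (hK : n + 1 < K) :
    hahnZ (n + 1) x l a M = ∑ k ∈ Finset.range K, (n.factorial : ℝ) * poch (-M) n *
      (((n + 1) * (n - M)) * (recFact (n + 1 - k) * hahnFactor x l (n + 1 - l - a - 1) M k)) := by
  rw [hahnZ_eq_sum (n + 1) x l a hM (by exact_mod_cast hK)]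
  refine Finset.sum_congr rfl fun k _ => ?_
  rw [show ((n : ℤ) + 1).toNat = n + 1 by omega, factorial_mul_poch_succ]
  push_cast
  ring

/-- The factor n (n - 1 - M) turns (n-1)! (-M)_{n-1} into the prefactor n! (-M)_n of the degree n
terms. For n = 0 both sides vanish. -/
theorem mul_hahnZ_pred_eq_sum (n : ℕ) (x l a : ℝ) {M : ℝ} (hM : ∀ m : ℕ, M ≠ m) {K : ℕ}
    (hK : n < K) :
    n * (n - 1 - M) * hahnZ (n - 1) x l a M =
      ∑ k ∈ Finset.range K, (n.factorial : ℝ) * poch (-M) n *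
      ((n - k) * (n + 1 - k) *
        (recFact (n + 1 - k) * hahnFactor x l (n - 1 - l - a - 1) M k)) := by
  rw [hahnZ_eq_sum ((n : ℤ) - 1) x l a hM (K := K) (by omega), Finset.mul_sum]
  refine Finset.sum_congr rfl fun k _ => ?_
  have h2 : ((n : ℝ) - k) * (n + 1 - k) * recFact (n + 1 - k) = recFact (n - 1 - k) := by
    rw [show (n : ℤ) - 1 - k = (n + 1 - k - 1 : ℤ) - 1 by ring, recFact_sub_one, recFact_sub_one]
    push_cast
    ring
  cases n with
  | zero =>
    rw [recFact_of_neg (z := ((0 : ℕ) : ℤ) - 1 - k) (by push_cast; omega)] at h2 ⊢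
    linear_combination (-(Nat.factorial 0 : ℝ)) * poch (-M) 0 *
      hahnFactor x l ((0 : ℕ) - 1 - l - a - 1) M k * h2
  | succ n =>
    rw [factorial_mul_poch_succ, show (((n + 1 : ℕ) : ℤ) - 1).toNat = n by omega]
    rw [← h2]
    push_cast
    ring

variable {x l a M : ℝ}

theorem hahnZ_three_term {n : ℕ} (hl : ∀ m : ℕ, l ≠ m) (hla : ∀ m : ℤ, l + a ≠ m)
    (hM : ∀ m : ℤ, M ≠ m) :
    -((l - n) * (n - l - a - 1)) / ((2 * n - l - a) * (2 * n - l - a - 1)) *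
        hahnZ (n + 1) x l a M +
      (-M + (l + a) / 2) * (n * (n - l - a - 1) + a * (l + a + 2) / 2) /
        ((2 * n - l - a) * (2 * n - l - a - 2) / 2) * hahnZ n x l a M +
      ((n - (l + a) + M - 1) * (n - M - 1)) * (-n * (n - a - 1)) /
        ((2 * n - l - a - 2) * (2 * n - l - a - 1)) * hahnZ (n - 1) x l a M =
    (x - M + a / 2) * hahnZ n x l a M := by
  have hM' : ∀ m : ℕ, M ≠ m := fun m => by exact_mod_cast hM m
  have h1 := hahnZ_succ_eq_sum n x l a hM' (K := n + 3) (by omega)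
  have h0 := hahnZ_natCast_eq_sum n x l a hM' (K := n + 3) (by omega)
  have hm := mul_hahnZ_pred_eq_sum n x l a hM' (K := n + 3) (by omega)
  -- The parameter e is the upper parameter n - l - a - 1 of the hypergeometric sum; neighbouring
  -- degrees shift it by one, and every denominator in n, l, a becomes e plus an integer.
  obtain ⟨e, rfl⟩ : ∃ e, a = n - l - 1 - e := ⟨n - l - 1 - a, by ring⟩
  have he : ∀ m : ℤ, e + m ≠ 0 := fun m h => hla (n - 1 + m) (by push_cast; linarith)
  rw [show ((n - (l + (n - l - 1 - e)) + M - 1) * (n - M - 1)) * (-n * (n - (n - l - 1 - e) - 1)) /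
        ((2 * n - l - (n - l - 1 - e) - 2) * (2 * n - l - (n - l - 1 - e) - 1)) *
        hahnZ (n - 1) x l (n - l - 1 - e) M = ((n - (l + (n - l - 1 - e)) + M - 1)) *
        (- (n - (n - l - 1 - e) - 1)) /
        ((2 * n - l - (n - l - 1 - e) - 2) * (2 * n - l - (n - l - 1 - e) - 1)) *
        (n * (n - 1 - M) * hahnZ (n - 1) x l (n - l - 1 - e) M) by ring, hm, h1, h0,
    ← sub_eq_zero]
  simp only [Finset.mul_sum, ← Finset.sum_add_distrib, ← Finset.sum_sub_distrib]
  -- Creative telescoping: the relation fails term by term, but the defect of the k-th term is G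
  -- (k+1) - G k for this rational multiple of the summand. G vanishes at 0 through its factor k,
  -- and at n + 3 through the reciprocal factorial.
  let G : ℕ → ℝ := fun k => (n.factorial : ℝ) * poch (-M) n *
    (-(k * (k - 1 - l) * (k - 1 - M)) / (e - 1 + k) * (recFact (n + 1 - k) * hahnFactor x l e M k))
  have hG : ∑ k ∈ Finset.range (n + 3), (G (k + 1) - G k) = 0 := by
    rw [Finset.sum_range_sub]
    simp only [G]
    rw [recFact_of_neg (by push_cast; omega)]
    simp
  rw [← hG]
  refine Finset.sum_congr rfl fun k _ => ?_
  have e0 : e ≠ 0 := by simpa using he 0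
  have ek : e - 1 + k ≠ 0 := fun h => he (k - 1) (by push_cast; linarith)
  have ek' : e + k ≠ 0 := by exact_mod_cast he k
  rw [show (n : ℝ) - l - (n - l - 1 - e) - 1 = e by ring,
    show (n : ℝ) + 1 - l - (n - l - 1 - e) - 1 = e + 1 by ring,
    show (n : ℝ) - 1 - l - (n - l - 1 - e) - 1 = e - 1 by ring,
    show 2 * (n : ℝ) - l - (n - l - 1 - e) = e + n + 1 by ring,
    hahnFactor_add_one e0, hahnFactor_sub_one ek]
  simp only [G]
  rw [hahnFactor_index_succ hl hM',
    show (n : ℤ) + 1 - ((k + 1 : ℕ) : ℤ) = (n + 1 - k : ℤ) - 1 by push_cast; ring, recFact_sub_one]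
  have hs : e + n + 1 ≠ 0 := fun h => he (n + 1) (by push_cast; linarith)
  have hs1 : e + n + 1 - 1 ≠ 0 := fun h => he n (by push_cast; linarith)
  have hs2 : e + n + 1 - 2 ≠ 0 := fun h => he (n - 1) (by push_cast; linarith)
  have k1 : (k : ℝ) - l ≠ 0 := sub_ne_zero.2 (hl k).symm
  have k2 : (k : ℝ) - M ≠ 0 := sub_ne_zero.2 (hM' k).symm
  have k3 : (k : ℝ) + 1 ≠ 0 := by positivity
  generalize recFact (n + 1 - k) = r
  generalize hahnFactor x l e M k = u
  generalize (n.factorial : ℝ) * poch (-M) n = X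
  push_cast
  rw [show e - 1 + ((k : ℝ) + 1) = e + k by ring]
  generalize (n : ℝ) = n at *
  generalize (k : ℝ) = k at *
  field_simp
  ring

end

/-! ### Contiguous relations with shifted parameters -/

section

variable {x l a M : ℝ}

theorem poch_neg_pred {n : ℕ} (hM : M ≠ 0) : poch (-(M - 1)) n = (M - n) / M * poch (-M) n := by
  have h := mul_poch_add_one (-M) n
  rw [show -(M - 1) = -M + 1 by ring]
  field_simp
  linarith

theorem poch_neg_succ {n : ℕ} (hM : M + 1 - n ≠ 0) :
    poch (-(M + 1)) n = (M + 1) / (M + 1 - n) * poch (-M) n := by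
  have h := mul_poch_add_one (-(M + 1)) n
  rw [show -(M + 1) + 1 = -M by ring] at h
  field_simp
  linarith

theorem mul_hahnZ_pred_pred_eq_sum (n : ℕ) (x l a : ℝ) {M : ℝ} (hM : ∀ m : ℕ, M ≠ m) {K : ℕ}
    (hK : n < K) :
    n * (n - 1) * (n - 1 - M) * (n - 2 - M) * hahnZ (n - 2) x l a M =
      ∑ k ∈ Finset.range K, (n.factorial : ℝ) * poch (-M) n *
      ((n - 1 - k) * (n - k) * (n + 1 - k) *
        (recFact (n + 1 - k) * hahnFactor x l (n - 2 - l - a - 1) M k)) := by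
  cases n with
  | zero =>
    simp only [Nat.cast_zero, zero_mul]
    symm
    refine Finset.sum_eq_zero fun k _ => ?_
    rcases Nat.eq_zero_or_pos k with rfl | hk
    · simp
    rcases Nat.eq_or_lt_of_le hk with rfl | hk
    · simp
    · rw [recFact_of_neg (by omega)]
      ring
  | succ n =>
    have h := mul_hahnZ_pred_eq_sum n x l a hM (K := K) (by omega)
    rw [show (((n + 1 : ℕ) : ℤ) - 2) = (n - 1 : ℤ) by push_cast; ring,
      show ((n + 1 : ℕ) : ℝ) * ((n + 1 : ℕ) - 1) * ((n + 1 : ℕ) - 1 - M) * ((n + 1 : ℕ) - 2 - M) *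
        hahnZ (n - 1) x l a M = (n + 1) * (n - M) * (n * (n - 1 - M) * hahnZ (n - 1) x l a M) by
        push_cast; ring, h, Finset.mul_sum]
    refine Finset.sum_congr rfl fun k _ => ?_
    rw [factorial_mul_poch_succ, show ((n : ℤ) + 1 - k) = ((n + 1 : ℕ) + 1 - k) - 1 by
      push_cast; ring, recFact_sub_one,
      show ((n + 1 : ℕ) : ℝ) - 2 - l - a - 1 = n - 1 - l - a - 1 by push_cast; ring]
    push_cast
    ring

/-- The case μ_2 = 1. Here the k-th terms of both sides agree, so no telescoping is needed. -/
theorem hahnZ_raise {n : ℕ} (hla : ∀ m : ℤ, l + a ≠ m) (hM : ∀ m : ℤ, M ≠ m) :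
    -((n - l - a - 1) * (n - l - a)) / ((2 * n - l - a) * (2 * n - l - a - 1)) *
        hahnZ n x l (a - 2) (M - 1) +
      (-M + (l + a) / 2) * (-n * (n - l - a - 1)) /
        ((2 * n - l - a) * (2 * n - l - a - 2) / 2) * hahnZ (n - 1) x l (a - 2) (M - 1) +
      ((n - (l + a) + M - 1) * (n - M - 1)) * (n * (n - 1)) /
        ((2 * n - l - a - 2) * (2 * n - l - a - 1)) * hahnZ (n - 2) x l (a - 2) (M - 1) =
    -hahnZ n x l a M := by
  have hM' : ∀ m : ℕ, M ≠ m := fun m => by exact_mod_cast hM m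
  have hM1 : ∀ m : ℕ, M - 1 ≠ m := fun m h => hM (m + 1) (by push_cast; linarith)
  have h1 := hahnZ_natCast_eq_sum n x l (a - 2) hM1 (K := n + 3) (by omega)
  have h0 := mul_hahnZ_pred_eq_sum n x l (a - 2) hM1 (K := n + 3) (by omega)
  have hm := mul_hahnZ_pred_pred_eq_sum n x l (a - 2) hM1 (K := n + 3) (by omega)
  have hr := hahnZ_natCast_eq_sum n x l a hM' (K := n + 3) (by omega)
  obtain ⟨e, rfl⟩ : ∃ e, a = n - l - 1 - e := ⟨n - l - 1 - a, by ring⟩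
  have he : ∀ m : ℤ, e + m ≠ 0 := fun m h => hla (n - 1 + m) (by push_cast; linarith)
  have nM : (n : ℝ) - M ≠ 0 := sub_ne_zero.2 (hM' n).symm
  have M0 : M ≠ 0 := by simpa using hM' 0
  rw [show (n : ℝ) - 1 - (M - 1) = n - M by ring] at h0 hm
  rw [show (n : ℝ) - 2 - (M - 1) = n - M - 1 by ring] at hm
  rw [show 2 * (n : ℝ) - l - (n - l - 1 - e) = e + n + 1 by ring]
  have hs : e + n + 1 ≠ 0 := fun h => he (n + 1) (by push_cast; linarith)
  have hs1 : e + n + 1 - 1 ≠ 0 := fun h => he n (by push_cast; linarith)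
  have hs2 : e + n + 1 - 2 ≠ 0 := fun h => he (n - 1) (by push_cast; linarith)
  -- The coefficients are regrouped to exhibit the multiples of the lower degree polynomials that
  -- `h0` and `hm` expand; the price is a division by n - M, which is nonzero.
  have g0 : ∀ c s : ℝ, c * (-n * (n - l - (n - l - 1 - e) - 1)) / s *
      hahnZ (n - 1) x l (n - l - 1 - e - 2) (M - 1) =
      -(c * e) / ((n - M) * s) *
      (n * (n - M) * hahnZ (n - 1) x l (n - l - 1 - e - 2) (M - 1)) := by
    intro c s
    field_simp
    ring
  have gm : ∀ c s : ℝ, c * (n - M - 1) * (n * (n - 1)) / s *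
      hahnZ (n - 2) x l (n - l - 1 - e - 2) (M - 1) =
      c / ((n - M) * s) * (n * (n - 1) * (n - M) * (n - M - 1) *
        hahnZ (n - 2) x l (n - l - 1 - e - 2) (M - 1)) := by
    intro c s
    field_simp
  rw [g0, gm, h1, h0, hm, hr]
  simp only [Finset.mul_sum, ← Finset.sum_add_distrib, ← Finset.sum_neg_distrib]
  refine Finset.sum_congr rfl fun k _ => ?_
  have e0 : e ≠ 0 := by simpa using he 0
  have e1 : e + 1 ≠ 0 := by exact_mod_cast he 1
  have kM : M - (k : ℝ) ≠ 0 := sub_ne_zero.2 (hM' k)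
  rw [show (n : ℝ) - l - (n - l - 1 - e) - 1 = e by ring,
    show (n : ℝ) - l - (n - l - 1 - e) = e + 1 by ring,
    show (n : ℝ) - l - (n - l - 1 - e - 2) - 1 = e + 1 + 1 by ring,
    show (n : ℝ) - 1 - l - (n - l - 1 - e - 2) - 1 = e + 1 by ring,
    show (n : ℝ) - 2 - l - (n - l - 1 - e - 2) - 1 = e by ring,
    hahnFactor_add_one e1, hahnFactor_add_one e0, hahnFactor_pred hM', poch_neg_pred M0]
  generalize recFact (n + 1 - k) = r
  generalize hahnFactor x l e M k = u
  generalize poch (-M) n = X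
  generalize (n.factorial : ℝ) = Y
  generalize (n : ℝ) = n at *
  generalize (k : ℝ) = k at *
  field_simp
  ring

/-- The telescoped identity for the k-th terms in `hahnZ_lower`, specialized to x = k and divided by
M + 1 - k. Isolating it keeps the rational function arithmetic small. -/
theorem hahn_lower_coeff_identity (n l e M k : ℝ) (hs : e + n + 1 ≠ 0) (hs1 : e + n ≠ 0) (hs2 : e + n - 1 ≠ 0)
    (hk1 : e - 1 + k ≠ 0) (hk2 : e - 2 + k ≠ 0) :
    (l - n) * (l - n - 1) * (n + 1) * (n + 2) * (n - M) / ((e + n + 1) * (e + n)) -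
      (n - 1 - e - 2 * M) * (l - n) * (l + e) * (n + 1) * (n + 2 - k) * (e - 1) /
        ((e + n + 1) * (e + n - 1) * (e - 1 + k)) -
      (e + M) * (l + e) * (l + e - 1) * (n + 1 - k) * (n + 2 - k) * (e - 2) * (e - 1) /
        ((e + n - 1) * (e + n) * (e - 2 + k) * (e - 1 + k)) =
    -(M - n + l + e - k) * (n + 2 - k) * (n + 1 - k) +
      (2 * k - 2 * M + n - l - 2 - e) * (n + 2 - k) * k * (k - 1 - l) / (e - 1 + k) +
      k * (k - 1) * (k - 1 - l) * (k - 2 - l) * (k - 2 - M) / ((e - 1 + k) * (e - 2 + k)) := by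
  field_simp
  ring

/-- The case μ_2 = -1, again by creative telescoping. The quadratic factor in M - x on the right is
the boundary coefficient of the next variable. -/
theorem hahnZ_lower {n : ℕ} (hl : ∀ m : ℕ, l ≠ m) (hla : ∀ m : ℤ, l + a ≠ m)
    (hM : ∀ m : ℤ, M ≠ m) :
    -((l - n) * (l - n - 1)) / ((2 * n - l - a) * (2 * n - l - a - 1)) *
        hahnZ (n + 2) x l (a + 2) (M + 1) +
      (-M + (l + a) / 2) * ((l - n) * (n - a - 1)) /
        ((2 * n - l - a) * (2 * n - l - a - 2) / 2) * hahnZ (n + 1) x l (a + 2) (M + 1) +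
      ((n - (l + a) + M - 1) * (n - M - 1)) * ((n - a - 1) * (n - a - 2)) /
        ((2 * n - l - a - 2) * (2 * n - l - a - 1)) * hahnZ n x l (a + 2) (M + 1) =
    ((-a + (M - x) - 1) * (-(M - x) - 1)) * hahnZ n x l a M := by
  have hM' : ∀ m : ℕ, M ≠ m := fun m => by exact_mod_cast hM m
  have hM1 : ∀ m : ℕ, M + 1 ≠ m := fun m h => hM (m - 1) (by push_cast; linarith)
  have h1 := hahnZ_succ_eq_sum (n + 1) x l (a + 2) hM1 (K := n + 5) (by omega)
  have h0 := hahnZ_natCast_eq_sum (n + 1) x l (a + 2) hM1 (K := n + 5) (by omega)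
  have hm := hahnZ_natCast_eq_sum n x l (a + 2) hM1 (K := n + 5) (by omega)
  have hr := hahnZ_natCast_eq_sum n x l a hM' (K := n + 5) (by omega)
  rw [show ((n + 1 : ℕ) : ℤ) + 1 = n + 2 by push_cast; ring] at h1
  rw [show ((n + 1 : ℕ) : ℤ) = n + 1 by push_cast; ring] at h0
  obtain ⟨e, rfl⟩ : ∃ e, a = n - l - 1 - e := ⟨n - l - 1 - a, by ring⟩
  have he : ∀ m : ℤ, e + m ≠ 0 := fun m h => hla (n - 1 + m) (by push_cast; linarith)
  have nM : M + 1 - (n : ℝ) ≠ 0 := sub_ne_zero.2 (hM1 n)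
  have M0 : M + 1 ≠ 0 := by simpa using hM1 0
  rw [show 2 * (n : ℝ) - l - (n - l - 1 - e) = e + n + 1 by ring]
  have hs : e + n + 1 ≠ 0 := fun h => he (n + 1) (by push_cast; linarith)
  have hs1 : e + n + 1 - 1 ≠ 0 := fun h => he n (by push_cast; linarith)
  have hs2 : e + n + 1 - 2 ≠ 0 := fun h => he (n - 1) (by push_cast; linarith)
  rw [h1, h0, hm, hr, ← sub_eq_zero]
  simp only [Finset.mul_sum, ← Finset.sum_add_distrib, ← Finset.sum_sub_distrib]
  -- The telescoping certificate; it vanishes at 0 by its factor k and at n + 5 by the reciprocal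
  -- factorial.
  let G : ℕ → ℝ := fun k => (n.factorial : ℝ) * poch (-M) n *
    (((2 * k - M - M + (n - l - 1 - e) - 1 - (k - x)) * (n + 2 - k) *
        (k * (k - 1 - l) * (k - 1 - M)) / (e - 1 + k) +
      k * (k - 1) * (k - 1 - l) * (k - 2 - l) * (k - 1 - M) * (k - 2 - M) /
        ((e - 1 + k) * (e - 2 + k))) * (recFact (n + 2 - k) * hahnFactor x l e M k))
  have hG : ∑ k ∈ Finset.range (n + 5), (G (k + 1) - G k) = 0 := by
    rw [Finset.sum_range_sub]
    simp only [G]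
    rw [recFact_of_neg (by push_cast; omega)]
    simp
  rw [← hG]
  refine Finset.sum_congr rfl fun k _ => ?_
  have ek : e - 1 + k ≠ 0 := fun h => he (k - 1) (by push_cast; linarith)
  have ek2 : e - 2 + k ≠ 0 := fun h => he (k - 2) (by push_cast; linarith)
  have ek2' : e - 1 - 1 + k ≠ 0 := fun h => he (k - 2) (by push_cast; linarith)
  have ek' : e + k ≠ 0 := by exact_mod_cast he k
  simp only [G]
  rw [factorial_mul_poch_succ, hahnFactor_index_succ hl hM',
    show (n : ℤ) + 2 - ((k + 1 : ℕ) : ℤ) = (n + 2 - k : ℤ) - 1 by push_cast; ring,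
    show (n : ℤ) + 1 - k = (n + 2 - k : ℤ) - 1 by ring,
    show (n : ℤ) + 1 + 1 - k = (n + 2 - k : ℤ) by ring, recFact_sub_one]
  push_cast
  rw [show (n : ℝ) - l - (n - l - 1 - e) - 1 = e by ring,
    show (n : ℝ) + 1 + 1 - l - (n - l - 1 - e + 2) - 1 = e by ring,
    show (n : ℝ) + 1 - l - (n - l - 1 - e + 2) - 1 = e - 1 by ring,
    show (n : ℝ) - l - (n - l - 1 - e + 2) - 1 = e - 1 - 1 by ring,
    hahnFactor_sub_one ek2', hahnFactor_sub_one ek, hahnFactor_succ hM, poch_neg_succ nM]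
  have k1 : (k : ℝ) - l ≠ 0 := sub_ne_zero.2 (hl k).symm
  have k2 : (k : ℝ) - M ≠ 0 := sub_ne_zero.2 (hM' k).symm
  have k3 : (k : ℝ) + 1 ≠ 0 := by positivity
  generalize recFact (n + 2 - k) = r
  generalize hahnFactor x l e M k = u
  generalize (n.factorial : ℝ) = Y
  generalize poch (-M) n = X
  rw [show e - 1 + ((k : ℝ) + 1) = e + k by ring, show e - 2 + ((k : ℝ) + 1) = e - 1 + k by ring,
    show e - 1 - 1 + (k : ℝ) = e - 2 + k by ring]
  rw [show e + (n : ℝ) + 1 - 1 = e + n by ring] at hs1 ⊢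
  rw [show e + (n : ℝ) + 1 - 2 = e + n - 1 by ring] at hs2 ⊢
  have core := hahn_lower_coeff_identity n l e M k hs hs1 hs2 ek ek2
  generalize (n : ℝ) = n at *
  generalize (k : ℝ) = k at *
  -- This is the common factor that the shift M ↦ M + 1 produces in all three terms on the left.
  have w : (M + 1) / (M + 1 - n) * ((M + 1 - k) / (M + 1)) * (n - (M + 1)) = -(M + 1 - k) := by
    field_simp
    ring
  -- This rewrites G (k+1) in terms of the k-th summand. It is a multiple of k - x, hence absent
  -- from `core`.
  have g : ((2 * (k + 1) - M - M + (n - l - 1 - e) - 1 - (k + 1 - x)) * (n + 2 - (k + 1)) *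
        ((k + 1) * (k + 1 - 1 - l) * (k + 1 - 1 - M)) / (e + k) +
      (k + 1) * (k + 1 - 1) * (k + 1 - 1 - l) * (k + 1 - 2 - l) * (k + 1 - 1 - M) *
        (k + 1 - 2 - M) / ((e + k) * (e - 1 + k))) *
      (-((e + k) * (k - x)) / ((k - l) * (k - M) * (k + 1))) =
      -(k - x) * ((2 * (k + 1) - M - M + (n - l - 1 - e) - 1 - (k + 1 - x)) * (n + 1 - k) +
        k * (k - 1 - l) * (k - 1 - M) / (e - 1 + k)) := by
    simp only [add_sub_cancel_right]
    field_simp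
    ring
  -- With inverses turned into independent atoms, all cancellations sit in `core`, `w` and `g`, and
  -- the goal is a polynomial combination of these.
  simp only [div_eq_mul_inv, mul_inv, inv_inv] at core w g ⊢
  generalize (e + n + 1)⁻¹ = i₀ at core w g ⊢
  generalize (e + n)⁻¹ = i₁ at core w g ⊢
  generalize (e + n - 1)⁻¹ = i₂ at core w g ⊢
  generalize (e - 1 + k)⁻¹ = j₁ at core w g ⊢
  generalize (e - 2 + k)⁻¹ = j₂ at core w g ⊢
  generalize (e + k)⁻¹ = j₀ at core w g ⊢
  generalize (M + 1 - n)⁻¹ = m₁ at core w g ⊢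
  generalize (M + 1)⁻¹ = m₂ at core w g ⊢
  generalize (k - l)⁻¹ = k₁ at core w g ⊢
  generalize (k - M)⁻¹ = k₂ at core w g ⊢
  generalize (k + 1)⁻¹ = k₃ at core w g ⊢
  linear_combination (-((l - n) * (l - n - 1)) * i₀ * i₁ *
      (Y * X * (n + 1) * (n + 2) * (n - M) * r * u) +
    (-M + (n - 1 - e) / 2) * (l - n) * (l + e) * i₀ * i₂ * 2 *
      (Y * X * (n + 1) * (n + 2 - k) * r * (e - 1) * j₁ * u) +
    (e + M) * (l + e) * (l + e - 1) * i₂ * i₁ *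
      (Y * X * (n + 1 - k) * (n + 2 - k) * r * (e - 2) * j₂ * (e - 1) * j₁ * u)) * w +
    (M + 1 - k) * (Y * X * r * u) * core - Y * X * (n + 2 - k) * r * u * g

end

/-! ### The contiguous relations in uniform form -/

theorem continuous_poch (k : ℕ) : Continuous fun a => poch a k :=
  (ascPochhammer ℝ k).continuous

theorem continuous_hahnZ_last (n : ℤ) (x l a c : ℝ) : Continuous fun M => hahnZ n x l a (M + c) := by
  unfold hahnZ
  split_ifs
  · unfold hahnReg
    refine continuous_finsetSum _ fun k _ => continuous_const.mul ?_
    exact (continuous_poch _).comp (by fun_prop)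
  · exact continuous_const

/-- The coefficients `B_0^{0,q}` for the unnormalized polynomials. -/
def endB (T L N : ℝ) : SignType → ℝ
  | .zero => -N + L / 2
  | .pos => -1
  | .neg => (T - L + N - 1) * (T - N - 1)

/-- The coefficients `B_1^{p,q}` in one variable. -/
def edgeB (n l a : ℝ) : SignType → SignType → ℝ
  | .zero, .zero => n * (n - l - a - 1) + a * (l + a + 2) / 2
  | .zero, .pos => -n * (n - l - a - 1)
  | .zero, .neg => (l - n) * (n - a - 1)
  | .pos, .zero => (l - n) * (n - l - a - 1)
  | .neg, .zero => -n * (n - a - 1)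
  | .pos, .pos => (n - l - a - 1) * (n - l - a)
  | .neg, .pos => n * (n - 1)
  | .pos, .neg => (l - n) * (l - n - 1)
  | .neg, .neg => (n - a - 1) * (n - a - 2)

/-- The denominators `b^p` as functions of `s`. -/
def edgeDen (s : ℝ) : SignType → ℝ
  | .zero => s * (s - 2) / 2
  | .pos => s * (s - 1)
  | .neg => (s - 2) * (s - 1)

theorem sum_signType (f : SignType → ℝ) : ∑ p, f p = f 1 + f 0 + f (-1) := by
  rw [SignType.univ_eq, Finset.sum_insert (by decide), Finset.sum_insert (by decide),
    Finset.sum_singleton]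
  ring

/-- The engine of the induction on d: here n, p, q stand for ν_1, μ_1, μ_2, and the coefficient on
the right is again an `endB`, now for the remaining variables. -/
theorem hahnReg_contiguous (n : ℕ) (x : ℝ) {l a : ℝ} (M : ℝ) (hl : ∀ m : ℕ, l ≠ m)
    (hla : ∀ m : ℤ, l + a ≠ m) (q : SignType) :
    ∑ p : SignType, endB n (l + a) M p * (edgeB n l a p q / edgeDen (2 * n - l - a) p) *
        hahnZ (n + (p - q)) x l (a - 2 * (q : ℝ)) (M - (q : ℝ)) =
      endB 0 a (M - x) q * hahnReg n x l a M := by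
  simp only [← hahnZ_natCast]
  revert M
  rw [← funext_iff]
  -- Both sides are polynomial in M, so it suffices to treat irrational M, where no Pochhammer
  -- symbol of M in a denominator vanishes.
  refine Continuous.ext_on dense_irrational ?_ ?_ ?_
  · refine continuous_finsetSum _ fun p _ => ?_
    refine Continuous.mul (Continuous.mul ?_ continuous_const) ?_
    · cases p <;> simp only [endB] <;> fun_prop
    · simpa only [sub_eq_add_neg] using continuous_hahnZ_last _ x l _ (-(q : ℝ))
  · refine Continuous.mul ?_ (by simpa using continuous_hahnZ_last n x l a 0)
    cases q <;> simp only [endB] <;> fun_prop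
  · intro M hM
    have hM' : ∀ m : ℤ, M ≠ m := fun m => hM.ne_int m
    simp only [sum_signType]
    cases q
    · have h := hahnZ_three_term (x := x) (n := n) hl hla hM'
      simp only [SignType.zero_eq_zero, SignType.coe_zero, SignType.coe_one, SignType.coe_neg_one]
      simp only [endB, edgeB, edgeDen, sub_zero, mul_zero, add_zero, ← sub_eq_add_neg]
      linear_combination h
    · have h := hahnZ_lower (x := x) (n := n) hl hla hM'
      simp only [SignType.neg_eq_neg_one, SignType.coe_zero, SignType.coe_one,
        SignType.coe_neg_one]
      simp only [endB, edgeB, edgeDen]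
      norm_num
      norm_num at h
      linear_combination h
    · have h := hahnZ_raise (x := x) (l := l) (n := n) hla hM'
      simp only [SignType.pos_eq_one, SignType.coe_zero, SignType.coe_one,
        SignType.coe_neg_one]
      simp only [endB, edgeB, edgeDen]
      norm_num [← sub_eq_add_neg]
      norm_num at h
      linear_combination h

/-! ### Splitting off the first variable -/

section sums

variable {M : Type} [AddCommMonoid M]

theorem tailSum_eq_sum_ite {n : ℕ} (y : Fin n → M) (j : ℕ) :
    tailSum y j = ∑ i : Fin n, if j ≤ i.val + 1 then y i else 0 := by
  rw [tailSum, Finset.sum_filter]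

theorem headSum_eq_sum_ite {n : ℕ} (y : Fin n → M) (j : ℕ) :
    headSum y j = ∑ i : Fin n, if i.val + 1 ≤ j then y i else 0 := by
  rw [headSum, Finset.sum_filter]

theorem tailSum_one {n : ℕ} (y : Fin n → M) : tailSum y 1 = ∑ i, y i := by
  simp [tailSum_eq_sum_ite]

theorem tailSum_add_two {n : ℕ} (y : Fin (n + 1) → M) (j : ℕ) :
    tailSum y (j + 2) = tailSum (Fin.tail y) (j + 1) := by
  simp [tailSum_eq_sum_ite, Fin.sum_univ_succ, Fin.tail]

theorem headSum_zero {n : ℕ} (y : Fin n → M) : headSum y 0 = 0 := by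
  simp [headSum_eq_sum_ite]

theorem headSum_succ {n : ℕ} (y : Fin (n + 1) → M) (j : ℕ) :
    headSum y (j + 1) = y 0 + headSum (Fin.tail y) j := by
  simp [headSum_eq_sum_ite, Fin.sum_univ_succ, Fin.tail]

theorem tailSum_one_succ {n : ℕ} (y : Fin (n + 1) → M) :
    tailSum y 1 = y 0 + tailSum y 2 := by
  rw [tailSum_add_two y 0, tailSum_one, tailSum_one, Fin.sum_univ_succ]
  rfl

theorem tailSum_two {n : ℕ} (y : Fin (n + 1) → M) : tailSum y 2 = ∑ i, Fin.tail y i := by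
  rw [tailSum_add_two y 0, tailSum_one]

end sums

theorem ext_cons_one {d : ℕ} (p : SignType) (μ : Fin d → SignType) :
    ext (Fin.cons p μ : Fin (d + 1) → SignType) 1 = p := by
  simp [ext]

theorem ext_cons_add_two {d : ℕ} (p : SignType) (μ : Fin d → SignType) (j : ℕ) :
    ext (Fin.cons p μ : Fin (d + 1) → SignType) (j + 2) = ext μ (j + 1) := by
  unfold ext
  by_cases h : j + 1 ≤ d
  · rw [dif_pos ⟨by omega, by omega⟩, dif_pos ⟨by omega, h⟩]
    exact Fin.cons_succ (α := fun _ => SignType) p μ ⟨j, by omega⟩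
  · rw [dif_neg (by omega), dif_neg (by omega)]

theorem b_eq_edgeDen {d : ℕ} (ν : Fin d → ℕ) (ℓ : Fin (d + 1) → ℝ) (i : Fin d) (p : SignType) :
    b ν ℓ i p = edgeDen (2 * (tailSum ν (i.val + 1) : ℕ) - tailSum ℓ (i.val + 1)) p := by
  cases p <;> rfl

theorem b_succ {d : ℕ} (ν : Fin (d + 1) → ℕ) (ℓ : Fin (d + 2) → ℝ) (i : Fin d) (p : SignType) :
    b ν ℓ i.succ p = b (Fin.tail ν) (Fin.tail ℓ) i p := by
  simp only [b_eq_edgeDen, Fin.val_succ]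
  rw [tailSum_add_two, tailSum_add_two]

theorem b_zero {d : ℕ} (ν : Fin (d + 1) → ℕ) (ℓ : Fin (d + 2) → ℝ) (p : SignType) :
    b ν ℓ 0 p = edgeDen (2 * ν 0 - ℓ 0 - (tailSum ℓ 2 - 2 * (tailSum ν 2 : ℕ))) p := by
  rw [b_eq_edgeDen]
  congr 1
  simp only [Fin.val_zero, zero_add]
  rw [tailSum_one_succ, tailSum_one_succ]
  push_cast
  ring

theorem B_succ {d : ℕ} (ν : Fin (d + 1) → ℕ) (ℓ : Fin (d + 2) → ℝ) (i : Fin d) (p q : SignType) :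
    B ν ℓ i.succ p q = B (Fin.tail ν) (Fin.tail ℓ) i p q := by
  simp only [B, Fin.val_succ, tailSum_add_two]
  rfl

theorem B_zero {d : ℕ} (ν : Fin (d + 1) → ℕ) (ℓ : Fin (d + 2) → ℝ) (p q : SignType) :
    B ν ℓ 0 p q = edgeB (ν 0) (ℓ 0) (tailSum ℓ 2 - 2 * (tailSum ν 2 : ℕ)) p q := by
  simp only [B, Fin.val_zero, zero_add, tailSum_one_succ, Fin.castSucc_zero]
  cases p <;> cases q <;> simp only [edgeB] <;> push_cast <;> ring

theorem shift_cons_zero {d : ℕ} (ν : Fin (d + 1) → ℕ) (p : SignType) (μ : Fin d → SignType) :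
    shift ν (Fin.cons p μ : Fin (d + 1) → SignType) 0 = ν 0 + ((p : ℤ) - (ext μ 1 : ℤ)) := by
  simp only [shift, Fin.val_zero, zero_add, ext_cons_one]
  rw [show (2 : ℕ) = 0 + 2 from rfl, ext_cons_add_two]

theorem shift_cons_succ {d : ℕ} (ν : Fin (d + 1) → ℕ) (p : SignType) (μ : Fin d → SignType)
    (i : Fin d) :
    shift ν (Fin.cons p μ : Fin (d + 1) → SignType) i.succ = shift (Fin.tail ν) μ i := by
  simp only [shift, Fin.val_succ, ext_cons_add_two]
  rfl

theorem sum_shift {d : ℕ} (ν : Fin d → ℕ) (μ : Fin d → SignType) :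
    ∑ i, shift ν μ i = ∑ i, (ν i : ℤ) + (ext μ 1 : ℤ) := by
  induction d with
  | zero => simp [ext]
  | succ d ih =>
    obtain ⟨p, μ, rfl⟩ : ∃ p μ', μ = Fin.cons p μ' := ⟨μ 0, Fin.tail μ, (Fin.cons_self_tail μ).symm⟩
    rw [Fin.sum_univ_succ, Fin.sum_univ_succ, shift_cons_zero, ext_cons_one]
    simp only [shift_cons_succ]
    rw [ih]
    simp only [Fin.tail]
    ring

/-- The product of the one-variable Hahn polynomials in `hahnQ`, without normalization. -/
def hahnP {d : ℕ} (ν : Fin d → ℕ) (x : Fin d → ℝ) (ℓ : Fin (d + 1) → ℝ) (N : ℝ) : ℝ :=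
  ∏ i : Fin d,
    hahnReg (ν i) (x i) (ℓ i.castSucc)
      (tailSum ℓ (i.val + 2) - 2 * (tailSum ν (i.val + 2) : ℕ))
      (N - headSum x i.val - (tailSum ν (i.val + 2) : ℕ))

theorem hahnQ_eq {d : ℕ} (ν : Fin d → ℕ) (x : Fin d → ℝ) (ℓ : Fin (d + 1) → ℝ) (N : ℝ) :
    hahnQ ν x ℓ N = 1 / poch (-N) (∑ i, ν i) * hahnP ν x ℓ N := rfl

theorem hahnP_succ {d : ℕ} (ν : Fin (d + 1) → ℕ) (x : Fin (d + 1) → ℝ) (ℓ : Fin (d + 2) → ℝ)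
    (N : ℝ) :
    hahnP ν x ℓ N = hahnReg (ν 0) (x 0) (ℓ 0) (tailSum ℓ 2 - 2 * (tailSum ν 2 : ℕ))
      (N - (tailSum ν 2 : ℕ)) * hahnP (Fin.tail ν) (Fin.tail x) (Fin.tail ℓ) (N - x 0) := by
  rw [hahnP, Fin.prod_univ_succ]
  congr 1
  · simp [headSum_zero]
  · refine Finset.prod_congr rfl fun i _ => ?_
    simp only [Fin.val_succ, tailSum_add_two, headSum_succ]
    rw [← sub_sub]
    rfl

/-- By `sum_shift` the shift changes |ν^2| by exactly μ_2, so the tail shift enters the first factor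
only through μ_2. Negative indices are consistent because `hahnZ` is zero in negative degree. -/
theorem atIndex_hahnP_cons {d : ℕ} (ν : Fin (d + 1) → ℕ) (x : Fin (d + 1) → ℝ)
    (ℓ : Fin (d + 2) → ℝ) (N : ℝ) (p : SignType) (μ : Fin d → SignType) :
    atIndex (fun ν' => hahnP ν' x ℓ N) (shift ν (Fin.cons p μ : Fin (d + 1) → SignType)) =
      hahnZ (ν 0 + ((p : ℤ) - (ext μ 1 : ℤ))) (x 0) (ℓ 0)
        (tailSum ℓ 2 - 2 * (tailSum ν 2 : ℕ) - 2 * (ext μ 1 : ℝ))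
        (N - (tailSum ν 2 : ℕ) - (ext μ 1 : ℝ)) *
      atIndex (fun ν' => hahnP ν' (Fin.tail x) (Fin.tail ℓ) (N - x 0)) (shift (Fin.tail ν) μ) := by
  unfold atIndex hahnZ
  have hiff : (∀ i, 0 ≤ shift ν (Fin.cons p μ : Fin (d + 1) → SignType) i) ↔
      0 ≤ ν 0 + ((p : ℤ) - (ext μ 1 : ℤ)) ∧ ∀ i, 0 ≤ shift (Fin.tail ν) μ i := by
    rw [Fin.forall_fin_succ, shift_cons_zero]
    simp only [shift_cons_succ]
  by_cases h0 : 0 ≤ ν 0 + ((p : ℤ) - (ext μ 1 : ℤ))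
  · by_cases h1 : ∀ i, 0 ≤ shift (Fin.tail ν) μ i
    · rw [if_pos (hiff.2 ⟨h0, h1⟩), if_pos h0, if_pos h1]
      beta_reduce
      rw [hahnP_succ]
      have ht : ((tailSum (fun i => (shift ν (Fin.cons p μ : Fin (d + 1) → SignType) i).toNat) 2 :
          ℕ) : ℝ) = (tailSum ν 2 : ℕ) + (ext μ 1 : ℝ) := by
        have h2 : ((tailSum (fun i =>
            (shift ν (Fin.cons p μ : Fin (d + 1) → SignType) i).toNat) 2 : ℕ) : ℤ) =
            (tailSum ν 2 : ℕ) + (ext μ 1 : ℤ) := by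
          rw [tailSum_two, tailSum_two]
          push_cast
          rw [← sum_shift]
          refine Finset.sum_congr rfl fun i _ => ?_
          rw [Fin.tail, shift_cons_succ, Int.toNat_of_nonneg (h1 i)]
        have h3 := congrArg (Int.cast : ℤ → ℝ) h2
        push_cast at h3
        exact h3
      simp only [ht, shift_cons_zero]
      congr 1
      · congr 1 <;> ring
      · congr 1
        funext i
        simp only [Fin.tail, shift_cons_succ]
    · rw [if_neg (fun h => h1 (hiff.1 h).2), if_neg h1, mul_zero]
  · rw [if_neg (fun h => h0 (hiff.1 h).1), if_neg h0, zero_mul]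

theorem sum_cons {d : ℕ} (f : (Fin (d + 1) → SignType) → ℝ) :
    ∑ μ, f μ = ∑ μ : Fin d → SignType, ∑ p : SignType, f (Fin.cons p μ) := by
  rw [← (Fin.consEquiv fun _ : Fin (d + 1) => SignType).sum_comp, Fintype.sum_prod_type_right]
  rfl

/-- With t = |ν^2| this passes between the boundary coefficients of the full parameters and those of
the one-variable relation, whose parameters have 2t and t subtracted. -/
theorem endB_shift (T L N t : ℝ) (p : SignType) :
    endB (T + t) (L + 2 * t) (N + t) p = endB T L N p := by
  cases p <;> simp only [endB] <;> ring

/-- The parameters are such that no denominator in the one-variable relations vanishes. -/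
def ParGeneric {d : ℕ} (ℓ : Fin (d + 1) → ℝ) : Prop :=
  (∀ (i : Fin d) (n : ℕ), ℓ i.castSucc ≠ n) ∧ ∀ (i : Fin d) (m : ℤ), tailSum ℓ (i.val + 1) ≠ m

theorem ParGeneric.tail {d : ℕ} {ℓ : Fin (d + 2) → ℝ} (h : ParGeneric ℓ) :
    ParGeneric (Fin.tail ℓ) := by
  refine ⟨fun i n => h.1 i.succ n, fun i m => ?_⟩
  have := h.2 i.succ m
  rwa [Fin.val_succ, tailSum_add_two] at this

/-- The product `∏_{i=1}^d B_i^{μ_i, μ_{i+1}} / ∏_{i=1}^d b_i^{μ_i}`. -/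
def innerC {d : ℕ} (ν : Fin d → ℕ) (ℓ : Fin (d + 1) → ℝ) (μ : Fin d → SignType) : ℝ :=
  (∏ i : Fin d, B ν ℓ i (ext μ (i.val + 1)) (ext μ (i.val + 2))) /
    ∏ i : Fin d, b ν ℓ i (ext μ (i.val + 1))

theorem innerC_cons {d : ℕ} (ν : Fin (d + 1) → ℕ) (ℓ : Fin (d + 2) → ℝ) (p : SignType)
    (μ : Fin d → SignType) :
    innerC ν ℓ (Fin.cons p μ : Fin (d + 1) → SignType) =
      edgeB (ν 0) (ℓ 0) (tailSum ℓ 2 - 2 * (tailSum ν 2 : ℕ)) p (ext μ 1) /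
        edgeDen (2 * ν 0 - ℓ 0 - (tailSum ℓ 2 - 2 * (tailSum ν 2 : ℕ))) p *
      innerC (Fin.tail ν) (Fin.tail ℓ) μ := by
  simp only [innerC, Fin.prod_univ_succ, Fin.val_zero, Fin.val_succ, zero_add, ext_cons_one,
    ext_cons_add_two, B_succ, b_succ, B_zero, b_zero]
  rw [mul_div_mul_comm]

theorem hahnP_recurrence {d : ℕ} (ν : Fin d → ℕ) (x : Fin d → ℝ) {ℓ : Fin (d + 1) → ℝ} (N : ℝ)
    (hℓ : ParGeneric ℓ) :
    ∑ μ : Fin d → SignType, endB ((∑ i, ν i : ℕ) : ℝ) (∑ i, ℓ i) N (ext μ 1) * innerC ν ℓ μ *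
        atIndex (fun ν' => hahnP ν' x ℓ N) (shift ν μ) =
      (∑ i, x i - N + ℓ (Fin.last d) / 2) * hahnP ν x ℓ N := by
  induction d generalizing N with
  | zero =>
    simp [ext, innerC, atIndex, hahnP, endB, ← SignType.zero_eq_zero]
  | succ d ih =>
    rw [sum_cons]
    set a := tailSum ℓ 2 - 2 * ((tailSum ν 2 : ℕ) : ℝ) with ha
    set t := ((tailSum ν 2 : ℕ) : ℝ) with ht
    have hla : ∀ m : ℤ, ℓ 0 + a ≠ m := by
      intro m h
      refine hℓ.2 0 (m + 2 * (tailSum ν 2 : ℕ)) ?_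
      simp only [Fin.val_zero, zero_add]
      rw [tailSum_one_succ]
      push_cast
      rw [← ht, ← h, ha]
      ring
    -- For a fixed tail of μ, summing over its first entry leaves the first Hahn factor times the
    -- corresponding summand of the (d-variable) tail problem with N - x 0.
    have key : ∀ μ : Fin d → SignType,
        ∑ p : SignType, endB ((∑ i, ν i : ℕ) : ℝ) (∑ i, ℓ i) N
            (ext (Fin.cons p μ : Fin (d + 1) → SignType) 1) *
            innerC ν ℓ (Fin.cons p μ : Fin (d + 1) → SignType) *
            atIndex (fun ν' => hahnP ν' x ℓ N) (shift ν (Fin.cons p μ : Fin (d + 1) → SignType)) =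
        hahnReg (ν 0) (x 0) (ℓ 0) a (N - t) *
          (endB ((∑ i, Fin.tail ν i : ℕ) : ℝ) (∑ i, Fin.tail ℓ i) (N - x 0) (ext μ 1) *
            innerC (Fin.tail ν) (Fin.tail ℓ) μ *
            atIndex (fun ν' => hahnP ν' (Fin.tail x) (Fin.tail ℓ) (N - x 0))
              (shift (Fin.tail ν) μ)) := by
      intro μ
      have h := hahnReg_contiguous (ν 0) (x 0) (l := ℓ 0) (N - t) (hℓ.1 0) hla (ext μ 1)
      have e1 : ((∑ i, ν i : ℕ) : ℝ) = ν 0 + t := by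
        rw [← tailSum_one, tailSum_one_succ]
        push_cast
        rfl
      have e2 : ∑ i, ℓ i = ℓ 0 + a + 2 * t := by
        rw [← tailSum_one, tailSum_one_succ, ha]
        ring
      have e3 : ((∑ i, Fin.tail ν i : ℕ) : ℝ) = 0 + t := by
        rw [ht, tailSum_two]
        ring
      have e4 : ∑ i, Fin.tail ℓ i = a + 2 * t := by
        rw [ha, tailSum_two]
        ring
      have e5 : N = N - t + t := by ring
      have e6 : N - x 0 = N - t - x 0 + t := by ring
      have e7 : ∀ p, endB ((∑ i, ν i : ℕ) : ℝ) (∑ i, ℓ i) N p = endB (ν 0) (ℓ 0 + a) (N - t) p := by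
        intro p
        rw [e1, e2]
        conv_lhs => rw [e5]
        rw [endB_shift]
      have e8 : endB ((∑ i, Fin.tail ν i : ℕ) : ℝ) (∑ i, Fin.tail ℓ i) (N - x 0) (ext μ 1) =
          endB 0 a (N - t - x 0) (ext μ 1) := by
        rw [e3, e4, e6, endB_shift]
      simp only [atIndex_hahnP_cons, ext_cons_one, innerC_cons]
      rw [e8]
      simp only [e7]
      calc _ = (∑ p : SignType, endB (ν 0) (ℓ 0 + a) (N - t) p *
            (edgeB (ν 0) (ℓ 0) a p (ext μ 1) / edgeDen (2 * ν 0 - ℓ 0 - a) p) *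
            hahnZ (ν 0 + (p - ext μ 1)) (x 0) (ℓ 0) (a - 2 * (ext μ 1 : ℝ))
              (N - t - (ext μ 1 : ℝ))) * (innerC (Fin.tail ν) (Fin.tail ℓ) μ *
            atIndex (fun ν' => hahnP ν' (Fin.tail x) (Fin.tail ℓ) (N - x 0))
              (shift (Fin.tail ν) μ)) := by
            rw [Finset.sum_mul]
            refine Finset.sum_congr rfl fun p _ => ?_
            ring
        _ = _ := by
            rw [h]
            ring
    simp only [key]
    rw [← Finset.mul_sum, ih _ _ _ hℓ.tail, hahnP_succ, Fin.sum_univ_succ x]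
    simp only [Fin.tail, Fin.succ_last]
    ring

/-! ### The recurrence for the full operator -/

theorem hahnReg_zero (n : ℕ) (l a M : ℝ) : hahnReg n 0 l a M = poch (-M) n := by
  rw [hahnReg, Finset.sum_eq_single 0]
  · simp [poch_zero]
  · intro k _ hk
    have : poch (-0) k = 0 := by
      simpa using poch_neg_natCast_eq_zero (n := 0) (Nat.pos_of_ne_zero hk)
    rw [this]
    simp
  · simp

theorem hahnP_zero {d : ℕ} (ν : Fin d → ℕ) (ℓ : Fin (d + 1) → ℝ) (N : ℝ) :
    hahnP ν 0 ℓ N = poch (-N) (∑ i, ν i) := by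
  induction d with
  | zero => simp [hahnP, poch_zero]
  | succ d ih =>
    have h0 : Fin.tail (0 : Fin (d + 1) → ℝ) = 0 := rfl
    rw [hahnP_succ, h0, Pi.zero_apply, hahnReg_zero, sub_zero, ih, ← tailSum_one ν,
      tailSum_one_succ, add_comm (ν 0), poch_add, tailSum_two, mul_comm]
    congr 2
    ring

/-- A lowering by one carries the factor ν_i, except for q = -p shifts, which lower by two and carry
ν_i (ν_i - 1). Thus ignored values always have coefficient zero. -/
theorem B_eq_zero {d : ℕ} {ν : Fin d → ℕ} {ℓ : Fin (d + 1) → ℝ} {i : Fin d} {p q : SignType}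
    (h : (ν i : ℤ) + ((p : ℤ) - (q : ℤ)) < 0) : B ν ℓ i p q = 0 := by
  have h0 : ν i = 0 ∨ ν i = 1 := by
    cases p <;> cases q <;> simp at h <;> omega
  rcases h0 with h0 | h0 <;> cases p <;> cases q <;> simp_all [B]

theorem innerC_eq_zero {d : ℕ} {ν : Fin d → ℕ} {ℓ : Fin (d + 1) → ℝ} {μ : Fin d → SignType}
    (h : ¬∀ i, 0 ≤ shift ν μ i) : innerC ν ℓ μ = 0 := by
  push Not at h
  obtain ⟨i, hi⟩ := h
  rw [innerC, Finset.prod_eq_zero (Finset.mem_univ i) (B_eq_zero hi), zero_div]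

theorem C_eq {d : ℕ} (ν : Fin d → ℕ) (ℓ : Fin (d + 1) → ℝ) (N : ℝ) (μ : Fin d → SignType) :
    C ν ℓ N μ = B₀ ν ℓ N (ext μ 1) * innerC ν ℓ μ := by
  rw [C, innerC, mul_div_assoc]

/-- The normalization depends only on |ν|, which changes by μ_1; the resulting quotient of
Pochhammer symbols is what distinguishes `B₀` from `endB`. -/
theorem B₀_div_poch {d : ℕ} (ν : Fin d → ℕ) (ℓ : Fin (d + 1) → ℝ) {N : ℝ} (hN : ∀ n : ℕ, N ≠ n)
    {T : ℕ} {q : SignType} (hT : (T : ℤ) = ∑ i, (ν i : ℤ) + (q : ℤ)) :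
    B₀ ν ℓ N q * (1 / poch (-N) T) =
      1 / poch (-N) (∑ i, ν i) * endB ((∑ i, ν i : ℕ) : ℝ) (∑ i, ℓ i) N q := by
  set S := ∑ i, ν i with hS
  have hS' : ∑ i, (ν i : ℤ) = S := by rw [hS]; push_cast; rfl
  rw [hS'] at hT
  have h1 := poch_neg_ne_zero hN S
  have h2 := poch_neg_ne_zero hN T
  simp only [B₀, ← hS]
  clear_value S
  cases q
  · obtain rfl : T = S := by simpa using hT
    simp only [endB]
    ring
  · obtain rfl : S = T + 1 := by simp at hT; omega
    have h3 : -N + (T : ℝ) ≠ 0 := fun h => hN T (by linarith)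
    rw [poch_succ]
    simp only [endB]
    push_cast
    field_simp
    ring
  · obtain rfl : T = S + 1 := by simp at hT; omega
    have h3 : -N + (S : ℝ) ≠ 0 := fun h => hN S (by linarith)
    rw [poch_succ]
    simp only [endB]
    field_simp
    ring

theorem C_mul_atIndex_hahnQ {d : ℕ} (ν : Fin d → ℕ) (x : Fin d → ℝ) (ℓ : Fin (d + 1) → ℝ) {N : ℝ}
    (hN : ∀ n : ℕ, N ≠ n) (μ : Fin d → SignType) :
    C ν ℓ N μ * atIndex (fun ν' => hahnQ ν' x ℓ N) (shift ν μ) =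
      1 / poch (-N) (∑ i, ν i) * (endB ((∑ i, ν i : ℕ) : ℝ) (∑ i, ℓ i) N (ext μ 1) *
        innerC ν ℓ μ * atIndex (fun ν' => hahnP ν' x ℓ N) (shift ν μ)) := by
  unfold atIndex
  split_ifs with h
  · have hT : ((∑ i, (shift ν μ i).toNat : ℕ) : ℤ) = ∑ i, (ν i : ℤ) + (ext μ 1 : ℤ) := by
      rw [← sum_shift]
      push_cast
      exact Finset.sum_congr rfl fun i _ => Int.toNat_of_nonneg (h i)
    have hB := B₀_div_poch ν ℓ hN hT
    beta_reduce
    rw [hahnQ_eq, C_eq]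
    linear_combination innerC ν ℓ μ * hahnP (fun i => (shift ν μ i).toNat) x ℓ N * hB
  · simp

theorem Generic.parGeneric {d : ℕ} {ℓ : Fin (d + 1) → ℝ} {N : ℝ} (h : Generic ℓ N) :
    ParGeneric ℓ := h.2

theorem sum_C_mul_atIndex_hahnQ {d : ℕ} (ν : Fin d → ℕ) (x : Fin d → ℝ) {ℓ : Fin (d + 1) → ℝ}
    {N : ℝ} (h : Generic ℓ N) :
    ∑ μ, C ν ℓ N μ * atIndex (fun ν' => hahnQ ν' x ℓ N) (shift ν μ) =
      (∑ i, x i - N + ℓ (Fin.last d) / 2) * hahnQ ν x ℓ N := by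
  simp only [C_mul_atIndex_hahnQ ν x ℓ h.1]
  rw [← Finset.mul_sum, hahnP_recurrence ν x N h.parGeneric, hahnQ_eq]
  ring

theorem hahnQ_zero {d : ℕ} (ν : Fin d → ℕ) (ℓ : Fin (d + 1) → ℝ) {N : ℝ} (hN : ∀ n : ℕ, N ≠ n) :
    hahnQ ν 0 ℓ N = 1 := by
  rw [hahnQ_eq, hahnP_zero]
  exact one_div_mul_cancel (poch_neg_ne_zero hN _)

theorem sum_C {d : ℕ} (ν : Fin d → ℕ) {ℓ : Fin (d + 1) → ℝ} {N : ℝ} (h : Generic ℓ N) :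
    ∑ μ, C ν ℓ N μ = -N + ℓ (Fin.last d) / 2 := by
  have h0 := sum_C_mul_atIndex_hahnQ ν 0 h
  rw [hahnQ_zero ν ℓ h.1] at h0
  simp only [Pi.zero_apply, Finset.sum_const_zero, zero_sub, mul_one] at h0
  rw [← h0]
  refine Finset.sum_congr rfl fun μ _ => ?_
  by_cases hμ : ∀ i, 0 ≤ shift ν μ i
  · rw [atIndex, if_pos hμ, hahnQ_zero _ ℓ h.1, mul_one]
  · rw [C_eq, innerC_eq_zero hμ]
    simp

theorem shift_zero {d k : ℕ} (ν : Fin d → ℕ) : shift ν (0 : Fin k → SignType) = fun i => (ν i : ℤ) := by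
  funext i
  simp [shift, ext]

theorem atIndex_natCast {d : ℕ} (f : (Fin d → ℕ) → ℝ) (ν : Fin d → ℕ) :
    atIndex f (fun i => (ν i : ℤ)) = f ν := by
  simp [atIndex]

theorem recOp_eq_sum {d : ℕ} (k : ℕ) (hk : k ≤ d) (ℓ : Fin (d + 1) → ℝ) (N : ℝ)
    (f : (Fin d → ℕ) → ℝ) (ν : Fin d → ℕ) :
    recOp k hk ℓ N f ν = ∑ μ : Fin k → SignType,
      C (headIdx hk ν) (headPar hk ν ℓ) (N - (tailSum ν (k + 1) : ℕ)) μ *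
        (atIndex f (shift ν μ) - f ν) := by
  rw [recOp, Finset.sum_filter]
  refine Finset.sum_congr rfl fun μ _ => ?_
  split_ifs with h
  · rfl
  · rw [not_not.1 h, shift_zero, atIndex_natCast, sub_self, mul_zero]

/-! ### Reduction to the full operator -/

theorem tailSum_split {M : Type} [AddCommMonoid M] {n k : ℕ} (hk : k ≤ n) (y : Fin n → M) {j : ℕ}
    (hj : j ≤ k + 1) :
    tailSum y j = (∑ i : Fin k, if j ≤ i.val + 1 then y (Fin.castLE hk i) else 0) +
      tailSum y (k + 1) := by
  obtain ⟨m, rfl⟩ := Nat.exists_eq_add_of_le hk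
  rw [tailSum_eq_sum_ite, tailSum_eq_sum_ite, Fin.sum_univ_add, Fin.sum_univ_add]
  have h1 : ∑ i : Fin k, (if k + 1 ≤ (Fin.castAdd m i).val + 1 then y (Fin.castAdd m i) else 0) =
      0 := by
    refine Finset.sum_eq_zero fun i _ => if_neg ?_
    simp
  rw [h1, zero_add]
  congr 1
  refine Finset.sum_congr rfl fun i _ => ?_
  rw [if_pos, if_pos] <;> rw [Fin.val_natAdd] <;> omega

theorem tailSum_headIdx {d k : ℕ} (hk : k ≤ d) (ν : Fin d → ℕ) {j : ℕ} (hj : j ≤ k + 1) :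
    tailSum ν j = tailSum (headIdx hk ν) j + tailSum ν (k + 1) := by
  rw [tailSum_split hk ν hj, tailSum_eq_sum_ite (headIdx hk ν)]
  rfl

theorem tailSum_headPar {d k : ℕ} (hk : k ≤ d) (ν : Fin d → ℕ) (ℓ : Fin (d + 1) → ℝ) {j : ℕ}
    (hj : j ≤ k + 1) :
    tailSum (headPar hk ν ℓ) j = tailSum ℓ j - 2 * (tailSum ν (k + 1) : ℕ) := by
  rw [tailSum_split (hk.trans (Nat.le_succ d)) ℓ hj, tailSum_eq_sum_ite, Fin.sum_univ_castSucc]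
  simp only [headPar, Fin.snoc_castSucc, Fin.snoc_last, Fin.val_castSucc, Fin.val_last, if_pos hj]
  rw [add_sub_assoc]
  rfl

theorem Generic.head {d k : ℕ} {ℓ : Fin (d + 1) → ℝ} {N : ℝ} (h : Generic ℓ N) (hk : k ≤ d)
    (ν : Fin d → ℕ) : Generic (headPar hk ν ℓ) (N - (tailSum ν (k + 1) : ℕ)) := by
  refine ⟨fun n hn => h.1 (n + tailSum ν (k + 1)) ?_, fun i n => ?_, fun i m hm => ?_⟩
  · push_cast
    linarith
  · simp only [headPar, Fin.snoc_castSucc]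
    exact h.2.1 _ n
  · rw [tailSum_headPar hk ν ℓ (by omega)] at hm
    refine h.2.2 (Fin.castLE hk i) (m + 2 * (tailSum ν (k + 1) : ℕ)) ?_
    push_cast
    rw [← hm]
    simp

theorem headSum_castAdd {k m : ℕ} (x : Fin (k + m) → ℝ) {j : ℕ} (hj : j ≤ k) :
    headSum x j = headSum (fun i : Fin k => x (Fin.castAdd m i)) j := by
  rw [headSum_eq_sum_ite, headSum_eq_sum_ite, Fin.sum_univ_add]
  simp only [Fin.val_castAdd, Fin.val_natAdd, add_eq_left]
  refine Finset.sum_eq_zero fun i _ => if_neg ?_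
  omega

theorem headSum_self {k : ℕ} (x : Fin k → ℝ) : headSum x k = ∑ i, x i := by
  rw [headSum_eq_sum_ite]
  refine Finset.sum_congr rfl fun i _ => if_pos ?_
  omega

/-- The factors of `hahnQ` that are not affected by shifts of the first `k` indices. -/
def tailFactor {k m : ℕ} (ν : Fin (k + m) → ℕ) (x : Fin (k + m) → ℝ) (ℓ : Fin (k + m + 1) → ℝ)
    (N : ℝ) : ℝ :=
  1 / poch (-N) (tailSum ν (k + 1)) * ∏ i : Fin m,
    hahnReg (ν (Fin.natAdd k i)) (x (Fin.natAdd k i)) (ℓ (Fin.natAdd k i).castSucc)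
      (tailSum ℓ (k + i.val + 2) - 2 * (tailSum ν (k + i.val + 2) : ℕ))
      (N - headSum x (k + i.val) - (tailSum ν (k + i.val + 2) : ℕ))

theorem tailFactor_congr {k m : ℕ} {ν ν' : Fin (k + m) → ℕ}
    (h : ∀ i : Fin m, ν (Fin.natAdd k i) = ν' (Fin.natAdd k i)) (x : Fin (k + m) → ℝ)
    (ℓ : Fin (k + m + 1) → ℝ) (N : ℝ) : tailFactor ν x ℓ N = tailFactor ν' x ℓ N := by
  have ht : ∀ j, k + 1 ≤ j → tailSum ν j = tailSum ν' j := by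
    intro j hj
    rw [tailSum_eq_sum_ite, tailSum_eq_sum_ite, Fin.sum_univ_add, Fin.sum_univ_add]
    congr 1
    · refine Finset.sum_congr rfl fun i _ => ?_
      rw [if_neg, if_neg] <;> simp <;> omega
    · simp only [h]
  unfold tailFactor
  rw [ht _ le_rfl]
  congr 1
  refine Finset.prod_congr rfl fun i _ => ?_
  rw [h, ht _ (by omega)]

/-- With t = |ν^{k+1}|, the symbol (-N)_{|ν|} factors as (-N)_t times a symbol based at -(N - t),
and lowering the last parameter by 2t and N by t reproduces a_j and N_j for j ≤ k. -/
theorem hahnQ_split {k m : ℕ} (ν : Fin (k + m) → ℕ) (x : Fin (k + m) → ℝ)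
    (ℓ : Fin (k + m + 1) → ℝ) (N : ℝ) :
    hahnQ ν x ℓ N = tailFactor ν x ℓ N *
      hahnQ (headIdx (Nat.le_add_right k m) ν) (fun i => x (Fin.castAdd m i))
        (headPar (Nat.le_add_right k m) ν ℓ) (N - (tailSum ν (k + 1) : ℕ)) := by
  have hk := Nat.le_add_right k m
  have h1 : poch (-N) (∑ i, ν i) = poch (-N) (tailSum ν (k + 1)) *
      poch (-(N - (tailSum ν (k + 1) : ℕ))) (∑ i, headIdx hk ν i) := by
    rw [← tailSum_one, ← tailSum_one, tailSum_headIdx hk ν (by omega), add_comm, poch_add]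
    congr 2
    ring
  have h2 : ∀ i : Fin k, hahnReg (ν (Fin.castAdd m i)) (x (Fin.castAdd m i))
      (ℓ (Fin.castAdd m i).castSucc)
      (tailSum ℓ ((Fin.castAdd m i).val + 2) - 2 * (tailSum ν ((Fin.castAdd m i).val + 2) : ℕ))
      (N - headSum x (Fin.castAdd m i).val - (tailSum ν ((Fin.castAdd m i).val + 2) : ℕ)) =
      hahnReg (headIdx hk ν i) (x (Fin.castAdd m i)) (headPar hk ν ℓ i.castSucc)
        (tailSum (headPar hk ν ℓ) (i.val + 2) - 2 * (tailSum (headIdx hk ν) (i.val + 2) : ℕ))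
        (N - (tailSum ν (k + 1) : ℕ) - headSum (fun i => x (Fin.castAdd m i)) i.val -
          (tailSum (headIdx hk ν) (i.val + 2) : ℕ)) := by
    intro i
    rw [Fin.val_castAdd, tailSum_headIdx hk ν (j := i.val + 2) (by omega),
      tailSum_headPar hk ν ℓ (by omega), headSum_castAdd x (by omega)]
    simp only [headPar, Fin.snoc_castSucc]
    push_cast
    congr 1 <;> ring
  rw [hahnQ, hahnQ, Fin.prod_univ_add, h1, Finset.prod_congr rfl fun i _ => h2 i, tailFactor]
  simp only [Fin.val_natAdd]
  rw [← div_div]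
  ring

theorem shift_of_le {d k : ℕ} (ν : Fin d → ℕ) (μ : Fin k → SignType) {i : Fin d}
    (hi : k ≤ i.val) : shift ν μ i = ν i := by
  have h1 : ext μ (i.val + 1) = 0 := dif_neg (by omega)
  have h2 : ext μ (i.val + 2) = 0 := dif_neg (by omega)
  simp [shift, h1, h2]

theorem atIndex_hahnQ_split {k m : ℕ} (ν : Fin (k + m) → ℕ) (x : Fin (k + m) → ℝ)
    (ℓ : Fin (k + m + 1) → ℝ) (N : ℝ) (μ : Fin k → SignType) :
    atIndex (fun ν' => hahnQ ν' x ℓ N) (shift ν μ) = tailFactor ν x ℓ N *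
      atIndex (fun ν' => hahnQ ν' (fun i => x (Fin.castAdd m i))
        (headPar (Nat.le_add_right k m) ν ℓ) (N - (tailSum ν (k + 1) : ℕ)))
        (shift (headIdx (Nat.le_add_right k m) ν) μ) := by
  have hk := Nat.le_add_right k m
  have hiff : (∀ i, 0 ≤ shift ν μ i) ↔ ∀ i, 0 ≤ shift (headIdx hk ν) μ i := by
    refine ⟨fun h i => h (Fin.castLE hk i), fun h i => ?_⟩
    rcases lt_or_ge i.val k with hi | hi
    · exact h ⟨i.val, hi⟩
    · rw [shift_of_le ν μ hi]
      positivity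
  unfold atIndex
  by_cases h : ∀ i, 0 ≤ shift ν μ i
  · rw [if_pos h, if_pos (hiff.1 h)]
    beta_reduce
    rw [hahnQ_split]
    have hν : ∀ i : Fin m, (shift ν μ (Fin.natAdd k i)).toNat = ν (Fin.natAdd k i) := by
      intro i
      rw [shift_of_le ν μ (by simp), Int.toNat_natCast]
    have ht : tailSum (fun i => (shift ν μ i).toNat) (k + 1) = tailSum ν (k + 1) := by
      rw [tailSum_eq_sum_ite, tailSum_eq_sum_ite, Fin.sum_univ_add, Fin.sum_univ_add]
      simp only [hν]
      congr 1
      refine Finset.sum_congr rfl fun i _ => ?_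
      rw [if_neg, if_neg] <;> simp
    rw [tailFactor_congr hν, ht]
    have hp : headPar hk (fun i => (shift ν μ i).toNat) ℓ = headPar hk ν ℓ := by
      unfold headPar
      rw [ht]
    rw [hp]
    rfl
  · rw [if_neg h, if_neg (fun h' => h (hiff.2 h')), mul_zero]

theorem recOp_hahnQ {d : ℕ} {ℓ : Fin (d + 1) → ℝ} {N : ℝ} (h : Generic ℓ N) (k : ℕ) (hk : k ≤ d)
    (ν : Fin d → ℕ) (x : Fin d → ℝ) :
    recOp k hk ℓ N (fun ν' => hahnQ ν' x ℓ N) ν = headSum x k * hahnQ ν x ℓ N := by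
  obtain ⟨m, rfl⟩ := Nat.exists_eq_add_of_le hk
  have hg := h.head hk ν
  have h1 := sum_C_mul_atIndex_hahnQ (headIdx hk ν) (fun i => x (Fin.castAdd m i)) hg
  have h2 := sum_C (headIdx hk ν) hg
  rw [recOp_eq_sum]
  simp only [atIndex_hahnQ_split, hahnQ_split ν, mul_sub, Finset.sum_sub_distrib]
  rw [← Finset.sum_mul, h2, headSum_castAdd x le_rfl, headSum_self]
  simp only [mul_left_comm _ (tailFactor ν x ℓ N)]
  rw [← Finset.mul_sum, h1]
  ring

section

open Polynomial

/-! ### Linear independence -/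

/-- The coefficient of `(-x)_k` in `hahnReg n x l a M`. -/
def hahnCoeff (n : ℕ) (l a M : ℝ) (k : ℕ) : ℝ :=
  poch (-(n : ℝ)) k * poch (n - l - a - 1) k / (poch (-l) k * (k.factorial : ℝ)) *
    poch (-M + k) (n - k)

/-- `hahnReg` as a polynomial in `x`. -/
def hahnPoly (n : ℕ) (l a M : ℝ) : ℝ[X] :=
  ∑ k ∈ Finset.range (n + 1), Polynomial.C (hahnCoeff n l a M k) * (ascPochhammer ℝ k).comp (-X)

theorem eval_hahnPoly (n : ℕ) (x l a M : ℝ) : (hahnPoly n l a M).eval x = hahnReg n x l a M := by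
  simp only [hahnPoly, eval_finsetSum, eval_mul, eval_C, eval_comp, eval_neg, eval_X]
  refine Finset.sum_congr rfl fun k _ => ?_
  rw [← poch, hahnCoeff]
  ring

theorem natDegree_ascPochhammer_comp_neg (k : ℕ) :
    ((ascPochhammer ℝ k).comp (-X)).natDegree = k := by
  rw [natDegree_comp, ascPochhammer_natDegree, natDegree_neg, natDegree_X, mul_one]

theorem ascPochhammer_comp_neg_ne_zero (k : ℕ) : (ascPochhammer ℝ k).comp (-X) ≠ 0 := by
  intro h
  have h1 := congrArg (Polynomial.eval (-1 : ℝ)) h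
  rw [eval_comp, eval_neg, eval_X, neg_neg, eval_zero] at h1
  exact (ascPochhammer_pos k (1 : ℝ) one_pos).ne' h1

theorem degree_ascPochhammer_comp_neg (k : ℕ) : ((ascPochhammer ℝ k).comp (-X)).degree = k := by
  rw [degree_eq_natDegree (ascPochhammer_comp_neg_ne_zero k), natDegree_ascPochhammer_comp_neg]

theorem degree_hahnPoly (n : ℕ) {l a : ℝ} (M : ℝ) (hl : ∀ m : ℕ, l ≠ m)
    (hla : ∀ m : ℤ, l + a ≠ m) : (hahnPoly n l a M).degree = n := by
  have hc : hahnCoeff n l a M n ≠ 0 := by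
    rw [hahnCoeff, Nat.sub_self, poch_zero, mul_one]
    refine div_ne_zero (mul_ne_zero ?_ ?_) (mul_ne_zero (poch_neg_ne_zero hl n) (by positivity))
    · refine poch_ne_zero fun m hm h => ?_
      have : (m : ℝ) < n := by exact_mod_cast hm
      linarith
    · refine poch_ne_zero fun m _ h => hla (n - 1 + m) ?_
      push_cast
      linarith
  have ht : (Polynomial.C (hahnCoeff n l a M n) * (ascPochhammer ℝ n).comp (-X)).degree = n := by
    rw [degree_C_mul hc, degree_ascPochhammer_comp_neg]
  rw [hahnPoly, Finset.sum_range_succ, degree_add_eq_right_of_degree_lt, ht]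
  rw [ht]
  refine lt_of_le_of_lt (degree_sum_le _ _) ((Finset.sup_lt_iff (WithBot.bot_lt_coe n)).2 ?_)
  intro k hk
  refine lt_of_le_of_lt ((degree_mul_le _ _).trans (add_le_add degree_C_le le_rfl)) ?_
  rw [degree_ascPochhammer_comp_neg, zero_add]
  exact Nat.cast_lt.2 (Finset.mem_range.1 hk)

theorem hahnReg_eq_zero_of_sum {l a : ℝ} (M : ℝ) (hl : ∀ m : ℕ, l ≠ m)
    (hla : ∀ m : ℤ, l + a ≠ m) (s : Finset ℕ) (c : ℕ → ℝ)
    (h : ∀ x, ∑ n ∈ s, c n * hahnReg n x l a M = 0) : ∀ n ∈ s, c n = 0 := by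
  let S : Polynomial.Sequence ℝ :=
    { elems' := fun n => hahnPoly n l a M
      degree_eq' := fun n => degree_hahnPoly n M hl hla }
  refine linearIndependent_iff'.1 S.linearIndependent s c ?_
  refine Polynomial.funext fun x => ?_
  rw [eval_finsetSum, eval_zero, ← h x]
  refine Finset.sum_congr rfl fun n _ => ?_
  rw [eval_smul, smul_eq_mul, ← eval_hahnPoly]

/-- Induction on d: for frozen x_1 the tail polynomials are independent, so the sum over each fibre
of equal tails vanishes. Within a fibre the first factors share a and M and have distinct degrees.
-/
theorem eq_zero_of_sum_hahnP {d : ℕ} {ℓ : Fin (d + 1) → ℝ} (hℓ : ParGeneric ℓ) (N : ℝ)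
    (s : Finset (Fin d → ℕ)) (c : (Fin d → ℕ) → ℝ)
    (h : ∀ x, ∑ ν ∈ s, c ν * hahnP ν x ℓ N = 0) : ∀ ν ∈ s, c ν = 0 := by
  induction d generalizing N with
  | zero =>
    intro ν hν
    have hs : s = {ν} := by
      ext ν'
      simp only [Finset.mem_singleton, Subsingleton.elim ν' ν, hν]
    have := h 0
    simpa [hs, hahnP] using this
  | succ d ih =>
    have step : ∀ x₀ : ℝ, ∀ ν' ∈ s.image Fin.tail, ∑ ν ∈ s with Fin.tail ν = ν',
        c ν * hahnReg (ν 0) x₀ (ℓ 0) (tailSum ℓ 2 - 2 * ((∑ i, ν' i : ℕ) : ℝ))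
          (N - ((∑ i, ν' i : ℕ) : ℝ)) = 0 := by
      intro x₀
      refine ih hℓ.tail (N - x₀) (s.image Fin.tail) _ fun x => ?_
      rw [← h (Fin.cons x₀ x)]
      refine Eq.trans ?_ (Finset.sum_fiberwise_of_maps_to (g := Fin.tail)
        (t := s.image Fin.tail) (fun ν hν => Finset.mem_image_of_mem _ hν) _)
      refine Finset.sum_congr rfl fun ν' _ => ?_
      rw [Finset.sum_mul]
      refine Finset.sum_congr rfl fun ν hν => ?_
      obtain rfl := (Finset.mem_filter.1 hν).2
      rw [hahnP_succ, tailSum_two ν, Fin.cons_zero, Fin.tail_cons, mul_assoc]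
    intro ν hν
    have hla : ∀ m : ℤ, ℓ 0 + (tailSum ℓ 2 - 2 * ((∑ i, Fin.tail ν i : ℕ) : ℝ)) ≠ m := by
      intro m hm
      refine hℓ.2 0 (m + 2 * (∑ i, Fin.tail ν i : ℕ)) ?_
      simp only [Fin.val_zero, zero_add]
      rw [tailSum_one_succ]
      push_cast at hm ⊢
      rw [← hm]
      ring
    have hinj : Set.InjOn (fun ν' : Fin (d + 1) → ℕ => ν' 0)
        (s.filter fun ν' => Fin.tail ν' = Fin.tail ν : Finset _) := by
      intro ν₁ h₁ ν₂ h₂ h₁₂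
      rw [← Fin.cons_self_tail ν₁, ← Fin.cons_self_tail ν₂,
        (Finset.mem_filter.1 h₁).2, (Finset.mem_filter.1 h₂).2]
      exact congrArg (fun n => (Fin.cons n (Fin.tail ν) : Fin (d + 1) → ℕ)) h₁₂
    have := hahnReg_eq_zero_of_sum (N - ((∑ i, Fin.tail ν i : ℕ) : ℝ)) (hℓ.1 0) hla
      ((s.filter fun ν' => Fin.tail ν' = Fin.tail ν).image fun ν' => ν' 0)
      (fun n => c (Fin.cons n (Fin.tail ν))) (fun x₀ => by
        rw [Finset.sum_image hinj, ← step x₀ (Fin.tail ν) (Finset.mem_image_of_mem _ hν)]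
        refine Finset.sum_congr rfl fun ν' hν' => ?_
        rw [← (Finset.mem_filter.1 hν').2, Fin.cons_self_tail]
        rfl) (ν 0)
      (Finset.mem_image_of_mem (fun ν' : Fin (d + 1) → ℕ => ν' 0)
        (Finset.mem_filter.2 ⟨hν, rfl⟩))
    rwa [Fin.cons_self_tail] at this

theorem eq_zero_of_linearCombination_hahnQ {d : ℕ} {ℓ : Fin (d + 1) → ℝ} {N : ℝ}
    (h : Generic ℓ N) (c : (Fin d → ℕ) →₀ ℝ)
    (hc : ∀ x, Finsupp.linearCombination ℝ (fun ν => hahnQ ν x ℓ N) c = 0) : c = 0 := by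
  have h1 := eq_zero_of_sum_hahnP h.parGeneric N c.support
    (fun ν => c ν * (1 / poch (-N) (∑ i, ν i))) fun x => by
      rw [← hc x, Finsupp.linearCombination_apply, Finsupp.sum]
      refine Finset.sum_congr rfl fun ν _ => ?_
      rw [hahnQ_eq, smul_eq_mul, mul_assoc]
  ext ν
  by_contra hν
  have h2 := h1 ν (Finsupp.mem_support_iff.2 hν)
  exact hν ((mul_eq_zero.1 h2).resolve_right (one_div_ne_zero (poch_neg_ne_zero h.1 _)))

/-! ### Commutation for generic parameters -/

theorem exists_atIndex_eq {d : ℕ} (n : Fin d → ℤ) :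
    ∃ c : (Fin d → ℕ) →₀ ℝ, ∀ f : (Fin d → ℕ) → ℝ,
      atIndex f n = Finsupp.linearCombination ℝ f c := by
  by_cases h : ∀ i, 0 ≤ n i
  · exact ⟨Finsupp.single (fun i => (n i).toNat) 1, fun f => by simp [atIndex, h]⟩
  · exact ⟨0, fun f => by simp only [atIndex, if_neg h, map_zero]⟩

/-- Evaluation at ν is a finite functional with coefficients independent of f, so it can be tested
on the family of Hahn polynomials. -/
theorem exists_recOp_eq {d : ℕ} (k : ℕ) (hk : k ≤ d) (ℓ : Fin (d + 1) → ℝ) (N : ℝ)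
    (ν : Fin d → ℕ) :
    ∃ c : (Fin d → ℕ) →₀ ℝ, ∀ f : (Fin d → ℕ) → ℝ,
      recOp k hk ℓ N f ν = Finsupp.linearCombination ℝ f c := by
  choose e he using fun μ : Fin k → SignType => exists_atIndex_eq (shift ν μ)
  refine ⟨∑ μ : Fin k → SignType,
    C (headIdx hk ν) (headPar hk ν ℓ) (N - (tailSum ν (k + 1) : ℕ)) μ •
      (e μ - Finsupp.single ν 1), fun f => ?_⟩
  rw [recOp_eq_sum, map_sum]
  refine Finset.sum_congr rfl fun μ _ => ?_
  simp [he]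

theorem exists_recOp_recOp_eq {d : ℕ} (j k : ℕ) (hj : j ≤ d) (hk : k ≤ d) (ℓ : Fin (d + 1) → ℝ)
    (N : ℝ) (ν : Fin d → ℕ) :
    ∃ c : (Fin d → ℕ) →₀ ℝ, ∀ f : (Fin d → ℕ) → ℝ,
      recOp j hj ℓ N (recOp k hk ℓ N f) ν = Finsupp.linearCombination ℝ f c := by
  choose e he using exists_recOp_eq k hk ℓ N
  obtain ⟨c, hc⟩ := exists_recOp_eq j hj ℓ N ν
  refine ⟨Finsupp.linearCombination ℝ e c, fun f => ?_⟩
  rw [hc, Finsupp.linearCombination_apply ℝ c, Finsupp.linearCombination_apply ℝ c, Finsupp.sum,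
    Finsupp.sum, map_sum]
  simp [he]

theorem recOp_const_mul {d : ℕ} (k : ℕ) (hk : k ≤ d) (ℓ : Fin (d + 1) → ℝ) (N a : ℝ)
    (f : (Fin d → ℕ) → ℝ) (ν : Fin d → ℕ) :
    recOp k hk ℓ N (fun ν' => a * f ν') ν = a * recOp k hk ℓ N f ν := by
  simp only [recOp_eq_sum, Finset.mul_sum]
  refine Finset.sum_congr rfl fun μ _ => ?_
  unfold atIndex
  split_ifs <;> ring

theorem recOp_comm {d : ℕ} {ℓ : Fin (d + 1) → ℝ} {N : ℝ} (h : Generic ℓ N) (j k : ℕ)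
    (hj : j ≤ d) (hk : k ≤ d) (f : (Fin d → ℕ) → ℝ) :
    recOp j hj ℓ N (recOp k hk ℓ N f) = recOp k hk ℓ N (recOp j hj ℓ N f) := by
  funext ν
  obtain ⟨c, hc⟩ := exists_recOp_recOp_eq j k hj hk ℓ N ν
  obtain ⟨c', hc'⟩ := exists_recOp_recOp_eq k j hk hj ℓ N ν
  have hzero : c - c' = 0 := by
    refine eq_zero_of_linearCombination_hahnQ h _ fun x => ?_
    have e : ∀ i (hi : i ≤ d), recOp i hi ℓ N (fun ν' => hahnQ ν' x ℓ N) =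
        fun ν' => headSum x i * hahnQ ν' x ℓ N := fun i hi => funext fun ν' =>
      recOp_hahnQ h i hi ν' x
    rw [map_sub, ← hc, ← hc', e, e, recOp_const_mul, recOp_const_mul, e, e]
    ring
  rw [hc, hc', sub_eq_zero.1 hzero]

end

section

open Filter Topology

/-! ### Perturbation of integer parameters -/

/-- Irrational numbers tending to `0`. -/
def irrNhds : Filter ℝ := 𝓝[{ε | Irrational ε}] 0

instance : NeBot irrNhds := mem_closure_iff_nhdsWithin_neBot.1 (dense_irrational 0)

theorem irrNhds_le : irrNhds ≤ 𝓝 0 := nhdsWithin_le_nhds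

theorem eventually_irrational : ∀ᶠ ε in irrNhds, Irrational ε := self_mem_nhdsWithin

theorem tailSum_natCast {n : ℕ} (y : Fin n → ℕ) (j : ℕ) :
    tailSum (fun i => (y i : ℝ)) j = (tailSum y j : ℕ) := by
  simp [tailSum]

/-- Each tail sum acquires a positive integer multiple of ε, so a single irrational serves all
conditions at once. -/
theorem generic_add_irrational {d : ℕ} (ℓ : Fin (d + 1) → ℕ) (N : ℕ) {ε : ℝ} (hε : Irrational ε) :
    Generic (fun i => (ℓ i : ℝ) + ε) (N + ε) := by
  refine ⟨fun n => (hε.natCast_add N).ne_nat n, fun i n => (hε.natCast_add _).ne_nat n,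
    fun i m => ?_⟩
  have h1 : tailSum (fun i => (ℓ i : ℝ) + ε) (i.val + 1) = (tailSum ℓ (i.val + 1) : ℕ) +
      ((Finset.univ.filter fun k : Fin (d + 1) => i.val + 1 ≤ k.val + 1).card : ℕ) * ε := by
    rw [← tailSum_natCast]
    simp only [tailSum, Finset.sum_add_distrib, Finset.sum_const, nsmul_eq_mul]
  rw [h1]
  refine ((hε.natCast_mul (Finset.card_ne_zero.2 ⟨i.castSucc, ?_⟩)).natCast_add _).ne_int m
  simp

theorem continuous_tailSum {n : ℕ} {y : ℝ → Fin n → ℝ} (hy : Continuous y) (j : ℕ) :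
    Continuous fun ε => tailSum (y ε) j := by
  unfold tailSum
  fun_prop

theorem continuous_headPar {d k : ℕ} (hk : k ≤ d) (ν : Fin d → ℕ) (ℓ : Fin (d + 1) → ℝ) :
    Continuous fun ε : ℝ => headPar hk ν (fun i => ℓ i + ε) := by
  refine continuous_pi fun i => ?_
  refine Fin.lastCases ?_ (fun i => ?_) i
  · simp only [headPar, Fin.snoc_last]
    exact (continuous_tailSum (by fun_prop) _).sub continuous_const
  · simp only [headPar, Fin.snoc_castSucc]
    fun_prop

theorem continuous_B {d : ℕ} (ν : Fin d → ℕ) {ℓ : ℝ → Fin (d + 1) → ℝ} (hℓ : Continuous ℓ)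
    (i : Fin d) (p q : SignType) : Continuous fun ε => B ν (ℓ ε) i p q := by
  have h1 := continuous_tailSum hℓ (i.val + 1)
  have h2 := continuous_tailSum hℓ (i.val + 2)
  cases p <;> cases q <;> simp only [B] <;> fun_prop

theorem continuous_b {d : ℕ} (ν : Fin d → ℕ) {ℓ : ℝ → Fin (d + 1) → ℝ} (hℓ : Continuous ℓ)
    (i : Fin d) (p : SignType) : Continuous fun ε => b ν (ℓ ε) i p := by
  have h1 := continuous_tailSum hℓ (i.val + 1)
  cases p <;> simp only [b] <;> fun_prop

theorem continuous_B₀ {d : ℕ} (ν : Fin d → ℕ) {ℓ : ℝ → Fin (d + 1) → ℝ} (hℓ : Continuous ℓ)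
    {N : ℝ → ℝ} (hN : Continuous N) (q : SignType) : Continuous fun ε => B₀ ν (ℓ ε) (N ε) q := by
  cases q <;> simp only [B₀] <;> fun_prop

theorem b_head {d k : ℕ} (hk : k ≤ d) (ν : Fin d → ℕ) (ℓ : Fin (d + 1) → ℝ) (i : Fin k)
    (p : SignType) : b (headIdx hk ν) (headPar hk ν ℓ) i p = b ν ℓ (Fin.castLE hk i) p := by
  rw [b_eq_edgeDen, b_eq_edgeDen, Fin.val_castLE, tailSum_headPar hk ν ℓ (by omega),
    tailSum_headIdx hk ν (j := i.val + 1) (by omega)]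
  congr 1
  push_cast
  ring

section coefficients

variable {d k : ℕ} (hk : k ≤ d) {ν : Fin d → ℕ} {ℓ : Fin (d + 1) → ℝ}

theorem tendsto_innerC (hν : Regular k ℓ ν) (μ : Fin k → SignType) :
    Tendsto (fun ε => innerC (headIdx hk ν) (headPar hk ν fun i => ℓ i + ε) μ) irrNhds
      (𝓝 (innerC (headIdx hk ν) (headPar hk ν ℓ) μ)) := by
  have hc : ContinuousAt
      (fun ε => innerC (headIdx hk ν) (headPar hk ν fun i => ℓ i + ε) μ) 0 := by
    unfold innerC
    refine ContinuousAt.div ?_ ?_ ?_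
    · exact (continuous_finsetProd _ fun i _ =>
        continuous_B _ (continuous_headPar hk ν ℓ) _ _ _).continuousAt
    · exact (continuous_finsetProd _ fun i _ =>
        continuous_b _ (continuous_headPar hk ν ℓ) _ _).continuousAt
    · refine Finset.prod_ne_zero_iff.2 fun i _ => ?_
      simp only [add_zero, b_head]
      exact hν _ i.isLt _
  have := hc.tendsto.mono_left irrNhds_le
  simpa using this

theorem tendsto_C (N : ℝ) (hν : Regular k ℓ ν) (μ : Fin k → SignType) :
    Tendsto (fun ε => C (headIdx hk ν) (headPar hk ν fun i => ℓ i + ε)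
      (N + ε - (tailSum ν (k + 1) : ℕ)) μ) irrNhds
      (𝓝 (C (headIdx hk ν) (headPar hk ν ℓ) (N - (tailSum ν (k + 1) : ℕ)) μ)) := by
  simp only [C_eq]
  refine Tendsto.mul ?_ (tendsto_innerC hk hν μ)
  have hc := (continuous_B₀ (headIdx hk ν) (continuous_headPar hk ν ℓ)
    (N := fun ε => N + ε - (tailSum ν (k + 1) : ℕ)) (by fun_prop) (ext μ 1)).tendsto 0
  have := hc.mono_left irrNhds_le
  simpa using this

/-- Convergence is required of the products of coefficient and value, not of the shifted values: for
|ν'| = N + 1 the normalization has a pole at ε = 0. -/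
theorem tendsto_recOp (N : ℝ) (hν : Regular k ℓ ν) {g : ℝ → (Fin d → ℕ) → ℝ}
    {g₀ : (Fin d → ℕ) → ℝ} (h0 : Tendsto (fun ε => g ε ν) irrNhds (𝓝 (g₀ ν)))
    (h : ∀ μ : Fin k → SignType,
      Tendsto (fun ε => C (headIdx hk ν) (headPar hk ν fun i => ℓ i + ε)
        (N + ε - (tailSum ν (k + 1) : ℕ)) μ * atIndex (g ε) (shift ν μ)) irrNhds
      (𝓝 (C (headIdx hk ν) (headPar hk ν ℓ) (N - (tailSum ν (k + 1) : ℕ)) μ *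
        atIndex g₀ (shift ν μ)))) :
    Tendsto (fun ε => recOp k hk (fun i => ℓ i + ε) (N + ε) (g ε) ν) irrNhds
      (𝓝 (recOp k hk ℓ N g₀ ν)) := by
  simp only [recOp_eq_sum, mul_sub]
  exact tendsto_finsetSum _ fun μ _ => (h μ).sub ((tendsto_C hk N hν μ).mul h0)

theorem mem_nbr_of_nonneg {μ : Fin k → SignType} (h : ∀ i, 0 ≤ shift ν μ i) :
    (fun i => (shift ν μ i).toNat) ∈ nbr k ν :=
  ⟨μ, funext fun i => (Int.toNat_of_nonneg (h i)).symm⟩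

theorem self_mem_nbr (k : ℕ) (ν : Fin d → ℕ) : ν ∈ nbr k ν := ⟨0, shift_zero ν⟩

theorem tendsto_atIndex {g : ℝ → (Fin d → ℕ) → ℝ} {g₀ : (Fin d → ℕ) → ℝ} {n : Fin d → ℤ}
    (h : (∀ i, 0 ≤ n i) → Tendsto (fun ε => g ε fun i => (n i).toNat) irrNhds
      (𝓝 (g₀ fun i => (n i).toNat))) :
    Tendsto (fun ε => atIndex (g ε) n) irrNhds (𝓝 (atIndex g₀ n)) := by
  unfold atIndex
  split_ifs with h0
  · exact h h0
  · exact tendsto_const_nhds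

theorem tendsto_recOp_of_nbr (N : ℝ) (hν : Regular k ℓ ν) {g : ℝ → (Fin d → ℕ) → ℝ}
    {g₀ : (Fin d → ℕ) → ℝ}
    (h : ∀ ν' ∈ nbr k ν, Tendsto (fun ε => g ε ν') irrNhds (𝓝 (g₀ ν'))) :
    Tendsto (fun ε => recOp k hk (fun i => ℓ i + ε) (N + ε) (g ε) ν) irrNhds
      (𝓝 (recOp k hk ℓ N g₀ ν)) :=
  tendsto_recOp hk N hν (h ν (self_mem_nbr k ν)) fun μ =>
    (tendsto_C hk N hν μ).mul (tendsto_atIndex fun hμ => h _ (mem_nbr_of_nonneg hμ))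

end coefficients

theorem recOp_comm_of_regular {d : ℕ} (ℓ : Fin (d + 1) → ℕ) (N : ℕ) (j k : ℕ) (hj : j ≤ d)
    (hk : k ≤ d) (f : (Fin d → ℕ) → ℝ) (ν : Fin d → ℕ)
    (h₁ : Regular j (fun i => (ℓ i : ℝ)) ν) (h₂ : Regular k (fun i => (ℓ i : ℝ)) ν)
    (h₃ : ∀ ν' ∈ nbr j ν, Regular k (fun i => (ℓ i : ℝ)) ν')
    (h₄ : ∀ ν' ∈ nbr k ν, Regular j (fun i => (ℓ i : ℝ)) ν') :
    recOp j hj (fun i => (ℓ i : ℝ)) N (recOp k hk (fun i => (ℓ i : ℝ)) N f) ν =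
      recOp k hk (fun i => (ℓ i : ℝ)) N (recOp j hj (fun i => (ℓ i : ℝ)) N f) ν := by
  have hjk := tendsto_recOp_of_nbr hj (N : ℝ) h₁ fun ν' hν' =>
    tendsto_recOp_of_nbr hk (N : ℝ) (h₃ ν' hν') (g := fun _ => f) (g₀ := f)
      fun _ _ => tendsto_const_nhds
  have hkj := tendsto_recOp_of_nbr hk (N : ℝ) h₂ fun ν' hν' =>
    tendsto_recOp_of_nbr hj (N : ℝ) (h₄ ν' hν') (g := fun _ => f) (g₀ := f)
      fun _ _ => tendsto_const_nhds
  refine tendsto_nhds_unique_of_eventuallyEq hjk hkj ?_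
  filter_upwards [eventually_irrational] with ε hε
  exact congrFun (recOp_comm (generic_add_irrational ℓ N hε) j k hj hk f) ν

/-! ### Limits of the Hahn polynomials -/

/-- Terms with k > l, whose denominator tends to 0, have zero numerator for every ε; the others are
continuous at 0. -/
theorem tendsto_hahnReg (n : ℕ) (x : ℝ) (l : ℕ) {a M : ℝ → ℝ} (ha : Continuous a)
    (hM : Continuous M) (h : ∀ k ≤ n, l < k → poch (-x) k = 0) :
    Tendsto (fun ε => hahnReg n x (l + ε) (a ε) (M ε)) irrNhds (𝓝 (hahnReg n x l (a 0) (M 0))) := by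
  unfold hahnReg
  refine tendsto_finsetSum _ fun k hk => ?_
  rcases lt_or_ge l k with hlk | hlk
  · rw [h k (by have := Finset.mem_range.1 hk; omega) hlk]
    simp
  · have h0 : poch (-(l : ℝ)) k ≠ 0 := by
      refine poch_ne_zero fun m hm h0 => ?_
      have : (m : ℝ) < l := by exact_mod_cast lt_of_lt_of_le hm hlk
      linarith
    have hp := continuous_poch
    have hc : ContinuousAt (fun ε : ℝ => poch (-(n : ℝ)) k * poch (n - (l + ε) - a ε - 1) k *
        poch (-x) k / (poch (-(l + ε)) k * (k.factorial : ℝ)) * poch (-M ε + k) (n - k)) 0 := by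
      refine ContinuousAt.mul (ContinuousAt.div ?_ ?_ ?_) ?_
      · exact ((continuous_const.mul ((hp k).comp (by fun_prop))).mul
          continuous_const).continuousAt
      · exact (((hp k).comp (by fun_prop)).mul continuous_const).continuousAt
      · rw [add_zero]
        exact mul_ne_zero h0 (by positivity)
      · exact ((hp (n - k)).comp (by fun_prop)).continuousAt
    have := hc.tendsto.mono_left irrNhds_le
    simpa using this

theorem tendsto_hahnP {d : ℕ} (ν : Fin d → ℕ) (x : Fin d → ℝ) (ℓ : Fin (d + 1) → ℕ) (N : ℕ)
    (h : ∀ i : Fin d, ∀ k ≤ ν i, ℓ i.castSucc < k → poch (-x i) k = 0) :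
    Tendsto (fun ε => hahnP ν x (fun i => (ℓ i : ℝ) + ε) (N + ε)) irrNhds
      (𝓝 (hahnP ν x (fun i => (ℓ i : ℝ)) N)) := by
  unfold hahnP
  refine tendsto_finsetProd _ fun i _ => ?_
  have := tendsto_hahnReg (ν i) (x i) (ℓ i.castSucc)
    (a := fun ε => tailSum (fun i => (ℓ i : ℝ) + ε) (i.val + 2) -
      2 * (tailSum ν (i.val + 2) : ℕ))
    (M := fun ε => N + ε - headSum x i.val - (tailSum ν (i.val + 2) : ℕ))
    ((continuous_tailSum (by fun_prop) _).sub continuous_const) (by fun_prop) (h i)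
  simpa using this

theorem tendsto_poch (N T : ℕ) :
    Tendsto (fun ε : ℝ => poch (-(N + ε)) T) irrNhds (𝓝 (poch (-N) T)) := by
  have h : Continuous fun ε : ℝ => poch (-(N + ε)) T := (continuous_poch T).comp (by fun_prop)
  have := (h.tendsto 0).mono_left irrNhds_le
  simpa using this

theorem poch_neg_natCast_ne_zero {N T : ℕ} (h : T ≤ N) : poch (-(N : ℝ)) T ≠ 0 := by
  refine poch_ne_zero fun m hm h0 => ?_
  have : (m : ℝ) < N := by exact_mod_cast lt_of_lt_of_le hm h
  linarith

theorem tendsto_hahnQ {d : ℕ} (ν : Fin d → ℕ) (x : Fin d → ℝ) (ℓ : Fin (d + 1) → ℕ) (N : ℕ)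
    (h : ∀ i : Fin d, ∀ k ≤ ν i, ℓ i.castSucc < k → poch (-x i) k = 0) (hN : ∑ i, ν i ≤ N) :
    Tendsto (fun ε => hahnQ ν x (fun i => (ℓ i : ℝ) + ε) (N + ε)) irrNhds
      (𝓝 (hahnQ ν x (fun i => (ℓ i : ℝ)) N)) := by
  simp only [hahnQ_eq]
  exact (tendsto_const_nhds.div (tendsto_poch N _) (poch_neg_natCast_ne_zero hN)).mul
    (tendsto_hahnP ν x ℓ N h)

theorem recOp_hahnQ_of_tendsto {d : ℕ} (ℓ : Fin (d + 1) → ℕ) (N : ℕ) (k : ℕ) (hk : k ≤ d)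
    (ν : Fin d → ℕ) (x : Fin d → ℝ)
    (h : Tendsto (fun ε => hahnQ ν x (fun i => (ℓ i : ℝ) + ε) (N + ε)) irrNhds
      (𝓝 (hahnQ ν x (fun i => (ℓ i : ℝ)) N)))
    (hL : Tendsto (fun ε => recOp k hk (fun i => (ℓ i : ℝ) + ε) (N + ε)
      (fun ν' => hahnQ ν' x (fun i => (ℓ i : ℝ) + ε) (N + ε)) ν) irrNhds
      (𝓝 (recOp k hk (fun i => (ℓ i : ℝ)) N (fun ν' => hahnQ ν' x (fun i => (ℓ i : ℝ)) N) ν))) :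
    recOp k hk (fun i => (ℓ i : ℝ)) N (fun ν' => hahnQ ν' x (fun i => (ℓ i : ℝ)) N) ν =
      headSum x k * hahnQ ν x (fun i => (ℓ i : ℝ)) N := by
  refine tendsto_nhds_unique_of_eventuallyEq hL (tendsto_const_nhds.mul h) ?_
  filter_upwards [eventually_irrational] with ε hε
  exact recOp_hahnQ (generic_add_irrational ℓ N hε) k hk ν x

end

section

open Filter Topology

/-! ### Integer parameters, all points -/

theorem tailSum_eq_add {M : Type} [AddCommMonoid M] {n : ℕ} (y : Fin n → M) (i : Fin n) :
    tailSum y (i.val + 1) = y i + tailSum y (i.val + 2) := by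
  have h : (Finset.univ.filter fun k : Fin n => i.val + 1 ≤ k.val + 1) =
      insert i (Finset.univ.filter fun k : Fin n => i.val + 2 ≤ k.val + 1) := by
    ext k
    simp only [Finset.mem_filter, Finset.mem_univ, true_and, Finset.mem_insert, Fin.ext_iff]
    omega
  rw [tailSum, h, Finset.sum_insert (by simp), tailSum]

/-- Take μ equal to 1 up to position i and 0 afterwards: consecutive differences are then nonzero
only at i. -/
theorem update_succ_mem_nbr {d k : ℕ} (ν : Fin d → ℕ) (i : Fin d) (hi : i.val < k) :
    Function.update ν i (ν i + 1) ∈ nbr k ν := by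
  refine ⟨fun j => if j.val ≤ i.val then 1 else 0, funext fun j => ?_⟩
  have hext : ∀ n : ℕ, ext (fun j : Fin k => if j.val ≤ i.val then (1 : SignType) else 0) (n + 1) =
      if n ≤ i.val then 1 else 0 := by
    intro n
    by_cases hn : n + 1 ≤ k
    · rw [ext, dif_pos ⟨by omega, hn⟩]
      simp
    · rw [ext, dif_neg (by omega), if_neg (by omega)]
  rw [shift, hext j.val, hext (j.val + 1)]
  by_cases hj : j = i
  · subst hj
    simp
  · have hj' : j.val ≠ i.val := fun h => hj (Fin.ext h)
    rw [Function.update_of_ne hj]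
    by_cases h1 : j.val ≤ i.val
    · rw [if_pos h1, if_pos (by omega)]
      simp
    · rw [if_neg h1, if_neg (by omega)]
      simp

/-- Raising ν_i by one stays in H, and adding the two bounds on ν_i + 1 gives s_i ≤ -2, so s_i, s_i
- 1 and s_i - 2 are all nonzero. -/
theorem regular_of_nbr_subset {d k : ℕ} {ℓ : Fin (d + 1) → ℕ} {N : ℕ}
    {ν : Fin d → ℕ} (h : nbr k ν ⊆ H ℓ N) : Regular k (fun i => (ℓ i : ℝ)) ν := by
  intro i hi p
  obtain ⟨h1, h2⟩ := (h (update_succ_mem_nbr ν i hi)).2.2 i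
  have h3 : tailSum (Function.update ν i (ν i + 1)) (i.val + 2) = tailSum ν (i.val + 2) := by
    unfold tailSum
    refine Finset.sum_congr rfl fun j hj => Function.update_of_ne ?_ _ _
    rintro rfl
    simp at hj
  rw [Function.update_self] at h1 h2
  rw [h3] at h2
  have h4 : 2 * tailSum ν (i.val + 1) + 2 ≤ tailSum ℓ (i.val + 1) := by
    have := tailSum_eq_add ℓ i.castSucc
    rw [Fin.val_castSucc] at this
    rw [this, tailSum_eq_add ν i]
    omega
  have h5 : 2 * ((tailSum ν (i.val + 1) : ℕ) : ℝ) + 2 ≤ (tailSum ℓ (i.val + 1) : ℕ) := by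
    exact_mod_cast h4
  rw [b_eq_edgeDen, tailSum_natCast]
  have hs0 : 2 * ((tailSum ν (i.val + 1) : ℕ) : ℝ) - (tailSum ℓ (i.val + 1) : ℕ) ≠ 0 := by linarith
  have hs1 : 2 * ((tailSum ν (i.val + 1) : ℕ) : ℝ) - (tailSum ℓ (i.val + 1) : ℕ) - 1 ≠ 0 := by
    linarith
  have hs2 : 2 * ((tailSum ν (i.val + 1) : ℕ) : ℝ) - (tailSum ℓ (i.val + 1) : ℕ) - 2 ≠ 0 := by
    linarith
  cases p
  · exact div_ne_zero (mul_ne_zero hs0 hs2) two_ne_zero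
  · exact mul_ne_zero hs2 hs1
  · exact mul_ne_zero hs0 hs1

theorem recOp_hahnQ_of_nbr_subset {d : ℕ} {ℓ : Fin (d + 1) → ℕ} {N : ℕ} (k : ℕ) (hk : k ≤ d)
    (ν : Fin d → ℕ) (x : Fin d → ℝ) (h : nbr k ν ⊆ H ℓ N) :
    recOp k hk (fun i => (ℓ i : ℝ)) N (fun ν' => hahnQ ν' x (fun i => (ℓ i : ℝ)) N) ν =
      headSum x k * hahnQ ν x (fun i => (ℓ i : ℝ)) N := by
  have ht : ∀ ν' ∈ nbr k ν, Tendsto (fun ε => hahnQ ν' x (fun i => (ℓ i : ℝ) + ε) (N + ε)) irrNhds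
      (𝓝 (hahnQ ν' x (fun i => (ℓ i : ℝ)) N)) := by
    intro ν' hν'
    obtain ⟨h1, -, h2⟩ := h hν'
    refine tendsto_hahnQ ν' x ℓ N (fun i n hn hl => ?_) h1
    have := (h2 i).1
    omega
  exact recOp_hahnQ_of_tendsto ℓ N k hk ν x (ht ν (self_mem_nbr k ν))
    (tendsto_recOp_of_nbr hk N (regular_of_nbr_subset h) ht)

/-! ### Integer parameters, points of the polyhedron -/

/-- For k > M the factor (-x)_k vanishes, and for k ≤ M the factor (-M + k)_{n-k} passes through 0.
-/
theorem hahnReg_eq_zero {n x M : ℕ} (hM : M < n) (hx : x ≤ M) (l a : ℝ) :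
    hahnReg n x l a M = 0 := by
  refine Finset.sum_eq_zero fun k hk => ?_
  rcases lt_or_ge M k with h | h
  · rw [poch_neg_natCast_eq_zero (lt_of_le_of_lt hx h)]
    simp
  · obtain ⟨r, rfl⟩ := Nat.exists_eq_add_of_le h
    have h1 : -((k + r : ℕ) : ℝ) + k = -(r : ℝ) := by
      push_cast
      ring
    rw [h1, poch_neg_natCast_eq_zero (n := r) (k := n - k) (by omega), mul_zero]

/-- If x_1 + |ν^2| ≤ N, the first factor has x_1 ≤ N - |ν^2| < ν_1 and vanishes. Otherwise |ν^2| > N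
- x_1, and the tail vanishes by induction. -/
theorem hahnP_eq_zero {d : ℕ} (ν x : Fin d → ℕ) (ℓ : Fin (d + 1) → ℝ) (N : ℕ)
    (hx : ∑ i, x i ≤ N) (hν : N < ∑ i, ν i) : hahnP ν (fun i => (x i : ℝ)) ℓ N = 0 := by
  induction d generalizing N with
  | zero => simp at hν
  | succ d ih =>
    rw [Fin.sum_univ_succ] at hx hν
    rw [hahnP_succ, tailSum_two ν]
    by_cases h : x 0 + ∑ i, Fin.tail ν i ≤ N
    · have h1 : (N : ℝ) - (∑ i, Fin.tail ν i : ℕ) = ((N - ∑ i, Fin.tail ν i : ℕ) : ℝ) := by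
        rw [Nat.cast_sub (by omega)]
      have h2 : ∑ i, Fin.tail ν i = ∑ i : Fin d, ν i.succ := rfl
      rw [h1, hahnReg_eq_zero (by omega) (by omega), zero_mul]
    · have h1 : (N : ℝ) - x 0 = ((N - x 0 : ℕ) : ℝ) := by
        rw [Nat.cast_sub (by omega)]
      rw [h1]
      refine mul_eq_zero_of_right _ (ih (Fin.tail ν) (Fin.tail x) (Fin.tail ℓ) (N - x 0) ?_ ?_)
      · simp only [Fin.tail]
        omega
      · omega

theorem sum_shift_head {d k : ℕ} (hk : k ≤ d) (ν : Fin d → ℕ) (μ : Fin k → SignType) :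
    ∑ i, shift ν μ i = ∑ i, (ν i : ℤ) + (ext μ 1 : ℤ) := by
  obtain ⟨m, rfl⟩ := Nat.exists_eq_add_of_le hk
  have h1 := sum_shift (headIdx hk ν) μ
  rw [Fin.sum_univ_add, Fin.sum_univ_add]
  have h2 : ∀ i : Fin m, shift ν μ (Fin.natAdd k i) = ν (Fin.natAdd k i) := fun i =>
    shift_of_le ν μ (by simp)
  simp only [h2]
  have h3 : ∑ i : Fin k, shift ν μ (Fin.castAdd m i) =
      ∑ i : Fin k, (ν (Fin.castAdd m i) : ℤ) + (ext μ 1 : ℤ) := h1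
  rw [h3]
  ring

theorem sum_eq_head {d k : ℕ} (hk : k ≤ d) (ν : Fin d → ℕ) :
    ∑ i, ν i = ∑ i, headIdx hk ν i + tailSum ν (k + 1) := by
  rw [← tailSum_one, ← tailSum_one, ← tailSum_headIdx hk ν (by omega)]

theorem recOp_hahnQ_of_mem_V {d : ℕ} {ℓ : Fin (d + 1) → ℕ} {N : ℕ} (k : ℕ) (hk : k ≤ d)
    {ν : Fin d → ℕ} (hν : ∑ i, ν i ≤ N) {x : Fin d → ℕ} (hx : x ∈ V ℓ N)
    (hreg : Regular k (fun i => (ℓ i : ℝ)) ν) :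
    recOp k hk (fun i => (ℓ i : ℝ)) N
        (fun ν' => hahnQ ν' (fun i => (x i : ℝ)) (fun i => (ℓ i : ℝ)) N) ν =
      headSum (fun i => (x i : ℝ)) k * hahnQ ν (fun i => (x i : ℝ)) (fun i => (ℓ i : ℝ)) N := by
  have hp : ∀ ν' : Fin d → ℕ, ∀ i : Fin d, ∀ n ≤ ν' i, ℓ i.castSucc < n →
      poch (-(x i : ℝ)) n = 0 := fun _ i n _ hn =>
    poch_neg_natCast_eq_zero (lt_of_le_of_lt (hx.1 i) hn)
  have ht := fun (ν' : Fin d → ℕ) => tendsto_hahnQ ν' (fun i => (x i : ℝ)) ℓ N (hp ν')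
  refine recOp_hahnQ_of_tendsto ℓ N k hk ν _ (ht ν hν)
    (tendsto_recOp hk N hreg (g := fun ε ν' => hahnQ ν' (fun i => (x i : ℝ))
      (fun i => (ℓ i : ℝ) + ε) (N + ε)) (ht ν hν) fun μ => ?_)
  by_cases hμ : ∀ i, 0 ≤ shift ν μ i
  swap
  · simp only [atIndex, if_neg hμ, mul_zero]
    exact tendsto_const_nhds
  have hsum : ((∑ i, (shift ν μ i).toNat : ℕ) : ℤ) = ((∑ i, ν i : ℕ) : ℤ) + (ext μ 1 : ℤ) := by
    push_cast
    rw [← sum_shift_head hk]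
    exact Finset.sum_congr rfl fun i _ => Int.toNat_of_nonneg (hμ i)
  by_cases hle : ∑ i, (shift ν μ i).toNat ≤ N
  · exact (tendsto_C hk (N : ℝ) hreg μ).mul (tendsto_atIndex fun _ => ht _ hle)
  -- The total degree changes by μ_1, so leaving |ν| ≤ N forces μ_1 = 1 and |ν| = N.
  have hq : ext μ 1 = SignType.pos := by
    cases hq : ext μ 1
    · rw [hq] at hsum
      simp only [SignType.zero_eq_zero, SignType.coe_zero] at hsum
      omega
    · rw [hq] at hsum
      simp only [SignType.neg_eq_neg_one, SignType.coe_neg_one] at hsum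
      omega
    · rfl
  have hN : ∑ i, ν i = N ∧ ∑ i, (shift ν μ i).toNat = N + 1 := by
    rw [hq] at hsum
    simp only [SignType.pos_eq_one, SignType.coe_one] at hsum
    omega
  -- With |ν| = N the boundary coefficient of the perturbed operator is exactly ε.
  have hB : ∀ (ℓ' : Fin (k + 1) → ℝ) (ε : ℝ),
      B₀ (headIdx hk ν) ℓ' (N + ε - (tailSum ν (k + 1) : ℕ)) (ext μ 1) = ε := by
    intro ℓ' ε
    rw [hq]
    simp only [B₀]
    rw [← hN.1, sum_eq_head hk ν]
    push_cast
    ring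
  have hB0 : ∀ ℓ' : Fin (k + 1) → ℝ,
      B₀ (headIdx hk ν) ℓ' (N - (tailSum ν (k + 1) : ℕ)) (ext μ 1) = 0 := fun ℓ' => by
    simpa using hB ℓ' 0
  simp only [atIndex, if_pos hμ, C_eq, hB0, zero_mul]
  -- Since (-(N+ε))_{N+1} = (-(N+ε))_N · (-ε), the coefficient ε cancels the pole up to sign. What
  -- remains tends to a multiple of `hahnP` at an index of total degree N + 1, which is 0 on V.
  have hlim : Tendsto (fun ε => -(innerC (headIdx hk ν) (headPar hk ν fun i => (ℓ i : ℝ) + ε) μ *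
      (1 / poch (-(N + ε)) N * hahnP (fun i => (shift ν μ i).toNat) (fun i => (x i : ℝ))
        (fun i => (ℓ i : ℝ) + ε) (N + ε)))) irrNhds (𝓝 0) := by
    have h0 := ((tendsto_innerC hk hreg μ).mul ((tendsto_const_nhds (x := (1 : ℝ)).div
      (tendsto_poch N N) (poch_neg_natCast_ne_zero le_rfl)).mul
      (tendsto_hahnP _ (fun i => (x i : ℝ)) ℓ N (hp fun i => (shift ν μ i).toNat)))).neg
    rw [hahnP_eq_zero (fun i => (shift ν μ i).toNat) x _ N hx.2.2 (by omega)] at h0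
    simpa using h0
  refine hlim.congr' ?_
  filter_upwards [eventually_irrational] with ε hε
  have hε0 : ε ≠ 0 := hε.ne_zero
  have hpN : poch (-((N : ℝ) + ε)) N ≠ 0 :=
    poch_neg_ne_zero (fun n => (hε.natCast_add N).ne_nat n) N
  rw [hB, hahnQ_eq, hN.2, poch_succ, show -((N : ℝ) + ε) + N = -ε by ring]
  field_simp

end

end

end HahnRec

/-! ### Assembly of the generic and integer cases -/

theorem theorem6p2 (d : ℕ) :
    -- generic real parameters: all indices, all points
    (∀ (ℓ : Fin (d + 1) → ℝ) (N : ℝ), HahnRec.Generic ℓ N →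
      (∀ (k : ℕ) (hk : k ≤ d), 1 ≤ k → ∀ (ν : Fin d → ℕ) (x : Fin d → ℝ),
        HahnRec.recOp k hk ℓ N (fun ν' => HahnRec.hahnQ ν' x ℓ N) ν =
          HahnRec.headSum x k * HahnRec.hahnQ ν x ℓ N) ∧
      (∀ (j k : ℕ) (hj : j ≤ d) (hk : k ≤ d) (f : (Fin d → ℕ) → ℝ),
        HahnRec.recOp j hj ℓ N (HahnRec.recOp k hk ℓ N f) =
          HahnRec.recOp k hk ℓ N (HahnRec.recOp j hj ℓ N f))) ∧
    -- nonnegative integer parameters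
    (∀ (ℓ : Fin (d + 1) → ℕ) (N : ℕ), HahnRec.Admissible ℓ N →
      -- all points, if the indices on the left-hand side belong to `H`
      (∀ (k : ℕ) (hk : k ≤ d), 1 ≤ k → ∀ (ν : Fin d → ℕ) (x : Fin d → ℝ),
        HahnRec.nbr k ν ⊆ HahnRec.H ℓ N →
        HahnRec.recOp k hk (fun i => (ℓ i : ℝ)) N
            (fun ν' => HahnRec.hahnQ ν' x (fun i => (ℓ i : ℝ)) N) ν =
          HahnRec.headSum x k * HahnRec.hahnQ ν x (fun i => (ℓ i : ℝ)) N) ∧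
      -- points of the polyhedron, for every index in `H` at which the coefficients are finite
      (∀ (k : ℕ) (hk : k ≤ d), 1 ≤ k → ∀ ν ∈ HahnRec.H ℓ N, ∀ x ∈ HahnRec.V ℓ N,
        HahnRec.Regular k (fun i => (ℓ i : ℝ)) ν →
        HahnRec.recOp k hk (fun i => (ℓ i : ℝ)) N
            (fun ν' => HahnRec.hahnQ ν' (fun i => (x i : ℝ)) (fun i => (ℓ i : ℝ)) N) ν =
          HahnRec.headSum (fun i => (x i : ℝ)) k *
            HahnRec.hahnQ ν (fun i => (x i : ℝ)) (fun i => (ℓ i : ℝ)) N) ∧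
      -- the operators commute wherever the coefficients involved are finite
      (∀ (j k : ℕ) (hj : j ≤ d) (hk : k ≤ d) (f : (Fin d → ℕ) → ℝ) (ν : Fin d → ℕ),
        HahnRec.Regular j (fun i => (ℓ i : ℝ)) ν →
        HahnRec.Regular k (fun i => (ℓ i : ℝ)) ν →
        (∀ ν' ∈ HahnRec.nbr j ν, HahnRec.Regular k (fun i => (ℓ i : ℝ)) ν') →
        (∀ ν' ∈ HahnRec.nbr k ν, HahnRec.Regular j (fun i => (ℓ i : ℝ)) ν') →
        HahnRec.recOp j hj (fun i => (ℓ i : ℝ)) N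
            (HahnRec.recOp k hk (fun i => (ℓ i : ℝ)) N f) ν =
          HahnRec.recOp k hk (fun i => (ℓ i : ℝ)) N
            (HahnRec.recOp j hj (fun i => (ℓ i : ℝ)) N f) ν)) := by

  refine ⟨fun ℓ N h => ⟨fun k hk _ ν x => HahnRec.recOp_hahnQ h k hk ν x,
    fun j k hj hk f => HahnRec.recOp_comm h j k hj hk f⟩, fun ℓ N _ => ⟨?_, ?_, ?_⟩⟩
  · intro k hk _ ν x h
    exact HahnRec.recOp_hahnQ_of_nbr_subset k hk ν x h
  · intro k hk _ ν hν x hx hreg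
    exact HahnRec.recOp_hahnQ_of_mem_V k hk hν.1 hx hreg
  · intro j k hj hk f ν h₁ h₂ h₃ h₄
    exact HahnRec.recOp_comm_of_regular ℓ N j k hj hk f ν h₁ h₂ h₃ h₄
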